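/- Let $n\ge 2$, let $1\le i\le n$, and let $c$ be a real number with $c>\frac{4}{\log n}$. A polygon with $n$ edges, up to translation, is its list of edge vectors $e_1,\dots,e_n\in\mathbb{R}^3$. Let $\mathrm{Arm}_3(n)$ be the set of lists with $\sum_l|e_l|=2$, $\mathrm{Arm}_2(n)\subset\mathrm{Arm}_3(n)$ the set of those whose edges all lie in the plane spanned by the first and third coordinate axes, and $\mathrm{Pol}_k(n)\subset\mathrm{Arm}_k(n)$ ($k=2,3$) the set of closed ones, $\sum_l e_l=0$. Let $\mathrm{Hopf}(q)=\bar q\,\mathbf{i}\,q$, applied coordinatewise to $\mathbb{H}^n=\mathbb{R}^{4n}$, the imaginary quaternions being identified with $\mathbb{R}^3$. Equip $\mathrm{Arm}_3(n)$, $\mathrm{Pol}_3(n)$, $\mathrm{Arm}_2(n)$, $\mathrm{Pol}_2(n)$ with the probability measures obtained by pushing forward under $\mathrm{Hopf}$ the normalized Riemannian volume of, respectively, the following submanifolds of $\mathbb{H}^n$: - the sphere $S^{4n-1}$ of radius $\sqrt2$ in $\mathbb{H}^n$; - the Stiefel manifold $V_2(\mathbb{C}^n)=\{u+v\,\mathbf{j}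 : u,v\in\mathbb{C}^n \text{ Hermitian orthonormal}\}$; - the disjoint union $S^{2n-1}\sqcup S^{2n-1}$ of the spheres of radius $\sqrt2$ in $(\mathbb{R}\oplus\mathbb{R}\mathbf{j})^n$ and $(\mathbb{R}\mathbf{i}\oplus\mathbb{R}\mathbf{k})^n$; - the disjoint union $V_2(\mathbb{R}^n)\sqcup\mathbf{i}V_2(\mathbb{R}^n)$, where $V_2(\mathbb{R}^n)=\{u+v\,\mathbf{j} : u,v\in\mathbb{R}^n\text{ orthonormal}\}$. Then, for a random space arm in $\mathrm{Arm}_3(n)$ and likewise for a random closed space polygon in $\mathrm{Pol}_3(n)$, $$P\left[|e_i|\ge c\,\frac{\log n}{n}\right]<\frac{1+c\log n}{n^c},$$ and, for a random plane arm in $\mathrm{Arm}_2(n)$ and likewise for a random closed plane polygon in $\mathrm{Pol}_2(n)$, $$P\left[|e_i|\ge c\,\frac{\log n}{n}\right]<\frac{1}{n^{c/2}}.$$ -/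

import Mathlib

open MeasureTheory
open scoped Quaternion BigOperators

noncomputable section

namespace RandomPolygon

/-- The quaternions, identified with `ℝ⁴`, carry their Borel sigma-algebra. -/
instance instMeasurableSpaceQuaternion : MeasurableSpace ℍ[ℝ] := borel ℍ[ℝ]

instance instBorelSpaceQuaternion : BorelSpace ℍ[ℝ] := ⟨rfl⟩

/-- Quaternionic `n`-space `ℍⁿ = ℝ⁴ⁿ` with its Euclidean norm. -/
abbrev QuatSpace (n : ℕ) : Type := PiLp 2 (fun _ : Fin n => ℍ[ℝ])

/-- Euclidean three-space. -/
abbrev Space : Type := EuclideanSpace ℝ (Fin 3)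

/-- The quaternion `𝐢`. -/
def quatI : ℍ[ℝ] := ⟨0, 1, 0, 0⟩

/-- The quaternion `𝐣`. -/
def quatJ : ℍ[ℝ] := ⟨0, 0, 1, 0⟩

/-- The Hopf map `q ↦ q̄ 𝐢 q`, whose values are purely imaginary quaternions, read as vectors of
`ℝ³` through their `𝐢`, `𝐣`, `𝐤` coordinates. -/
def hopf (q : ℍ[ℝ]) : Space :=
  !₂[(star q * quatI * q).imI, (star q * quatI * q).imJ, (star q * quatI * q).imK]

/-- The coordinatewise Hopf map, from `ℍⁿ` to lists of `n` edge vectors. -/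
def hopfList {n : ℕ} (q : QuatSpace n) : Fin n → Space := fun l => hopf (q l)

/-! ### The polygon spaces

A polygon up to translation is its list of edge vectors. -/

/-- Space arms: `n`-edge (not necessarily closed) polygons of total length `2` in `ℝ³`. -/
def Arm3 (n : ℕ) : Set (Fin n → Space) := {e | ∑ l, ‖e l‖ = 2}

/-- Plane arms: space arms all of whose edges lie in the fixed `𝐢 ⊕ 𝐤` plane. -/
def Arm2 (n : ℕ) : Set (Fin n → Space) := {e | e ∈ Arm3 n ∧ ∀ l, e l 1 = 0}

/-- Closed space polygons of total length `2`. -/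
def Pol3 (n : ℕ) : Set (Fin n → Space) := {e | e ∈ Arm3 n ∧ ∑ l, e l = 0}

/-- Closed plane polygons of total length `2`. -/
def Pol2 (n : ℕ) : Set (Fin n → Space) := {e | e ∈ Arm2 n ∧ ∑ l, e l = 0}

/-! ### The model spaces -/

/-- The sphere `S⁴ⁿ⁻¹` of radius `√2` in `ℍⁿ`. -/
def modelArm3 (n : ℕ) : Set (QuatSpace n) := Metric.sphere 0 (Real.sqrt 2)

/-- The disjoint union `S²ⁿ⁻¹ ⊔ S²ⁿ⁻¹` of the spheres of radius `√2` in `(1 ⊕ 𝐣)ⁿ` and in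
`(𝐢 ⊕ 𝐤)ⁿ`. -/
def modelArm2 (n : ℕ) : Set (QuatSpace n) :=
  {q | q ∈ Metric.sphere (0 : QuatSpace n) (Real.sqrt 2) ∧
    ((∀ l, (q l).imI = 0 ∧ (q l).imK = 0) ∨ (∀ l, (q l).re = 0 ∧ (q l).imJ = 0))}

/-- The Stiefel manifold `V₂(ℂⁿ)` of Hermitian orthonormal 2-frames `(u, v)`, placed in `ℍⁿ` as
`u + v 𝐣`. -/
def modelPol3 (n : ℕ) : Set (QuatSpace n) :=
  {q | ∃ u v : EuclideanSpace ℂ (Fin n), ‖u‖ = 1 ∧ ‖v‖ = 1 ∧ inner ℂ u v = 0 ∧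
    ∀ l, q l = ((u l : ℂ) : ℍ[ℝ]) + ((v l : ℂ) : ℍ[ℝ]) * quatJ}

/-- The disjoint union `V₂(ℝⁿ) ⊔ 𝐢 V₂(ℝⁿ)` in `ℍⁿ`. -/
def modelPol2 (n : ℕ) : Set (QuatSpace n) :=
  {q | ∃ u v : EuclideanSpace ℝ (Fin n), ‖u‖ = 1 ∧ ‖v‖ = 1 ∧ inner ℝ u v = 0 ∧
    ((∀ l, q l = ((u l : ℝ) : ℍ[ℝ]) + ((v l : ℝ) : ℍ[ℝ]) * quatJ) ∨
      (∀ l, q l = quatI * (((u l : ℝ) : ℍ[ℝ]) + ((v l : ℝ) : ℍ[ℝ]) * quatJ)))}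

/-! ### The Hopf map takes the model spaces to the polygon spaces -/

@[simp] theorem quatI_re : quatI.re = 0 := rfl
@[simp] theorem quatI_imI : quatI.imI = 1 := rfl
@[simp] theorem quatI_imJ : quatI.imJ = 0 := rfl
@[simp] theorem quatI_imK : quatI.imK = 0 := rfl
@[simp] theorem quatJ_re : quatJ.re = 0 := rfl
@[simp] theorem quatJ_imI : quatJ.imI = 0 := rfl
@[simp] theorem quatJ_imJ : quatJ.imJ = 1 := rfl
@[simp] theorem quatJ_imK : quatJ.imK = 0 := rfl

theorem hopf_zero (q : ℍ[ℝ]) :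
    hopf q 0 = q.re ^ 2 + q.imI ^ 2 - q.imJ ^ 2 - q.imK ^ 2 := by
  simp [hopf]; ring

theorem hopf_one (q : ℍ[ℝ]) : hopf q 1 = 2 * (q.imI * q.imJ - q.re * q.imK) := by
  simp [hopf]; ring

theorem hopf_two (q : ℍ[ℝ]) : hopf q 2 = 2 * (q.imI * q.imK + q.re * q.imJ) := by
  simp [hopf]; ring

theorem norm_sq_quat (q : ℍ[ℝ]) :
    ‖q‖ ^ 2 = q.re ^ 2 + q.imI ^ 2 + q.imJ ^ 2 + q.imK ^ 2 := by
  rw [← Quaternion.normSq_def', Quaternion.normSq_eq_norm_mul_self, sq]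

/-- The Hopf map squares norms. -/
theorem norm_hopf (q : ℍ[ℝ]) : ‖hopf q‖ = ‖q‖ ^ 2 := by
  have h : ‖hopf q‖ ^ 2 = (‖q‖ ^ 2) ^ 2 := by
    rw [EuclideanSpace.norm_sq_eq, Fin.sum_univ_three, norm_sq_quat]
    simp only [Real.norm_eq_abs, sq_abs]
    rw [hopf_zero, hopf_one, hopf_two]
    ring
  exact (sq_eq_sq₀ (norm_nonneg _) (by positivity)).1 h

theorem hopfList_mem_Arm3 {n : ℕ} {q : QuatSpace n} (hq : q ∈ modelArm3 n) :
    hopfList q ∈ Arm3 n := by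
  have h : ‖q‖ = Real.sqrt 2 := by simpa [modelArm3] using hq
  have h2 : ‖q‖ ^ 2 = 2 := by rw [h]; exact Real.sq_sqrt (by norm_num)
  rw [PiLp.norm_sq_eq_of_L2] at h2
  simpa [Arm3, hopfList, norm_hopf] using h2

theorem hopfList_mem_Arm2 {n : ℕ} {q : QuatSpace n} (hq : q ∈ modelArm2 n) :
    hopfList q ∈ Arm2 n := by
  refine ⟨hopfList_mem_Arm3 hq.1, fun l => ?_⟩
  rw [hopfList, hopf_one]
  rcases hq.2 with h | h
  · simp [h l]
  · simp [h l]

theorem hopfList_mem_Pol3_aux {n : ℕ} {q : QuatSpace n} (p : Fin n → ℍ[ℝ]) (hp : ∀ l, q l = p l)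
    (h1 : ∑ l, ((p l).re ^ 2 + (p l).imI ^ 2) = 1)
    (h2 : ∑ l, ((p l).imJ ^ 2 + (p l).imK ^ 2) = 1)
    (h3 : ∑ l, ((p l).imI * (p l).imJ - (p l).re * (p l).imK) = 0)
    (h4 : ∑ l, ((p l).imI * (p l).imK + (p l).re * (p l).imJ) = 0) :
    hopfList q ∈ Pol3 n := by
  have hl : hopfList q = fun l => hopf (p l) := funext fun l => congrArg hopf (hp l)
  rw [hl]
  refine ⟨?_, ?_⟩
  · show ∑ l, ‖hopf (p l)‖ = 2
    have h : ∑ l, ‖hopf (p l)‖ = ∑ l, ((p l).re ^ 2 + (p l).imI ^ 2) +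
        ∑ l, ((p l).imJ ^ 2 + (p l).imK ^ 2) := by
      rw [← Finset.sum_add_distrib]
      exact Finset.sum_congr rfl fun l _ => by rw [norm_hopf, norm_sq_quat]; ring
    rw [h, h1, h2]; norm_num
  · ext k
    rw [WithLp.ofLp_sum, Finset.sum_apply]
    fin_cases k
    · show ∑ l, hopf (p l) 0 = 0
      have h : ∑ l, hopf (p l) 0 = ∑ l, ((p l).re ^ 2 + (p l).imI ^ 2) -
          ∑ l, ((p l).imJ ^ 2 + (p l).imK ^ 2) := by
        rw [← Finset.sum_sub_distrib]
        exact Finset.sum_congr rfl fun l _ => by rw [hopf_zero]; ring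
      rw [h, h1, h2, sub_self]
    · show ∑ l, hopf (p l) 1 = 0
      simp only [hopf_one]
      rw [← Finset.mul_sum, h3, mul_zero]
    · show ∑ l, hopf (p l) 2 = 0
      simp only [hopf_two]
      rw [← Finset.mul_sum, h4, mul_zero]

theorem hopfList_mem_Pol3 {n : ℕ} {q : QuatSpace n} (hq : q ∈ modelPol3 n) :
    hopfList q ∈ Pol3 n := by
  obtain ⟨u, v, hu, hv, huv, hq⟩ := hq
  have hu2 : ∑ l, ((u l).re ^ 2 + (u l).im ^ 2) = 1 := by
    have h := EuclideanSpace.norm_sq_eq u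
    rw [hu] at h
    rw [← one_pow 2, h]
    exact Finset.sum_congr rfl fun l _ => by
      rw [← Complex.normSq_eq_norm_sq, Complex.normSq_apply]; ring
  have hv2 : ∑ l, ((v l).re ^ 2 + (v l).im ^ 2) = 1 := by
    have h := EuclideanSpace.norm_sq_eq v
    rw [hv] at h
    rw [← one_pow 2, h]
    exact Finset.sum_congr rfl fun l _ => by
      rw [← Complex.normSq_eq_norm_sq, Complex.normSq_apply]; ring
  rw [PiLp.inner_apply] at huv
  have hre := congrArg Complex.re huv
  have him := congrArg Complex.im huv
  rw [Complex.re_sum] at hre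
  rw [Complex.im_sum] at him
  refine hopfList_mem_Pol3_aux _ hq ?_ ?_ ?_ ?_
  · exact (Finset.sum_congr rfl fun l _ => by simp).trans hu2
  · exact (Finset.sum_congr rfl fun l _ => by simp).trans hv2
  · have h : ∑ l, -(inner ℂ (u l) (v l)).im = 0 := by
      rw [Finset.sum_neg_distrib, him]; simp
    exact (Finset.sum_congr rfl fun l _ => by simp; ring).trans h
  · exact (Finset.sum_congr rfl fun l _ => by simp; ring).trans hre

theorem hopfList_mem_Pol2 {n : ℕ} {q : QuatSpace n} (hq : q ∈ modelPol2 n) :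
    hopfList q ∈ Pol2 n := by
  obtain ⟨u, v, hu, hv, huv, hq⟩ := hq
  have hu2 : ∑ l, (u l) ^ 2 = 1 := by
    rw [← one_pow 2, ← hu, EuclideanSpace.norm_sq_eq]
    simp
  have hv2 : ∑ l, (v l) ^ 2 = 1 := by
    rw [← one_pow 2, ← hv, EuclideanSpace.norm_sq_eq]
    simp
  have huv2 : ∑ l, u l * v l = 0 := by
    rw [PiLp.inner_apply] at huv
    rw [← huv]
    exact Finset.sum_congr rfl fun l _ => by simp [mul_comm]
  have key : hopfList q ∈ Pol3 n ∧ ∀ l, hopfList q l 1 = 0 := by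
    rcases hq with hq | hq
    · refine ⟨?_, fun l => ?_⟩
      · refine hopfList_mem_Pol3_aux _ hq ?_ ?_ ?_ ?_
        · exact (Finset.sum_congr rfl fun l _ => by simp).trans hu2
        · exact (Finset.sum_congr rfl fun l _ => by simp).trans hv2
        · exact Finset.sum_eq_zero fun l _ => by simp
        · exact (Finset.sum_congr rfl fun l _ => by simp).trans huv2
      · rw [show hopfList q l = _ from congrArg hopf (hq l), hopf_one]
        simp
    · refine ⟨?_, fun l => ?_⟩
      · refine hopfList_mem_Pol3_aux _ hq ?_ ?_ ?_ ?_
        · exact (Finset.sum_congr rfl fun l _ => by simp).trans hu2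
        · exact (Finset.sum_congr rfl fun l _ => by simp).trans hv2
        · exact Finset.sum_eq_zero fun l _ => by simp
        · exact (Finset.sum_congr rfl fun l _ => by simp).trans huv2
      · rw [show hopfList q l = _ from congrArg hopf (hq l), hopf_one]
        simp
  exact ⟨⟨key.1.1, key.2⟩, key.1.2⟩

/-- The Hopf map from the sphere to space arms. -/
def hopfArm3 (n : ℕ) (q : modelArm3 n) : Arm3 n := ⟨hopfList q.1, hopfList_mem_Arm3 q.2⟩

/-- The Hopf map from the pair of spheres to plane arms. -/
def hopfArm2 (n : ℕ) (q : modelArm2 n) : Arm2 n := ⟨hopfList q.1, hopfList_mem_Arm2 q.2⟩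

/-- The Hopf map from the complex Stiefel manifold to closed space polygons. -/
def hopfPol3 (n : ℕ) (q : modelPol3 n) : Pol3 n := ⟨hopfList q.1, hopfList_mem_Pol3 q.2⟩

/-- The Hopf map from the two copies of the real Stiefel manifold to closed plane polygons. -/
def hopfPol2 (n : ℕ) (q : modelPol2 n) : Pol2 n := ⟨hopfList q.1, hopfList_mem_Pol2 q.2⟩

/-! ### The symmetric measures -/

/-- The normalized Riemannian volume `dVol_M / Vol M` of a compact `d`-dimensional submanifold `M`
of `ℍⁿ` with the subspace metric. The volume of `M` is, up to a constant factor depending only on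
`d`, which the normalization cancels, the `d`-dimensional Hausdorff measure of `M`. -/
def normalizedVolume {n : ℕ} (M : Set (QuatSpace n)) (d : ℝ) : Measure M :=
  ((μH[d] : Measure M) Set.univ)⁻¹ • (μH[d] : Measure M)

/-- The symmetric measure on space arms, from `S⁴ⁿ⁻¹`. -/
def symmArm3 (n : ℕ) : Measure (Arm3 n) :=
  (normalizedVolume (modelArm3 n) (4 * n - 1)).map (hopfArm3 n)

/-- The symmetric measure on plane arms, from `S²ⁿ⁻¹ ⊔ S²ⁿ⁻¹`. -/
def symmArm2 (n : ℕ) : Measure (Arm2 n) :=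
  (normalizedVolume (modelArm2 n) (2 * n - 1)).map (hopfArm2 n)

/-- The symmetric measure on closed space polygons, from `V₂(ℂⁿ)`, of real dimension `4n - 4`. -/
def symmPol3 (n : ℕ) : Measure (Pol3 n) :=
  (normalizedVolume (modelPol3 n) (4 * n - 4)).map (hopfPol3 n)

/-- The symmetric measure on closed plane polygons, from `V₂(ℝⁿ) ⊔ 𝐢 V₂(ℝⁿ)`, of
dimension `2n - 3`. -/
def symmPol2 (n : ℕ) : Measure (Pol2 n) :=
  (normalizedVolume (modelPol2 n) (2 * n - 3)).map (hopfPol2 n)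

end RandomPolygon

end

/-! The Hopf map squares norms, so the claim concerns the tail of `‖q i‖ ^ 2` on a model space `M`.
No volume is computed: only the invariance of Hausdorff measure under isometries is used. Let `a` be
a Gaussian vector in ℍⁿ, ℂⁿ or ℝⁿ, according to the model. For every `a ≠ 0` some quaternionic
Householder reflection preserves `M` and carries `‖⟨a, q⟩‖² / ‖a‖²` to `‖q i‖²`
(`exists_reflectOn`). By Fubini, the tail probability is then the average over `q ∈ M` of a Gaussian
probability in `a` with `q` fixed (`normalizedVolume_tail_le`).

For fixed `q`, `‖⟨a, q⟩‖²` is the squared projection of `a` onto a real subspace of dimension 4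
(space models) or 2 (plane models), doubled for arms because the spheres have radius √2 (the
`exists_frame_of_mem_...` lemmas). Splitting the Gaussian along this subspace gives the exact
proportion of `a` whose squared projection is at least `x‖a‖²`: with `2M` the dimension and `0 ≤ x <
1`, it is `(1-x)^(M-2) (1+(M-2)x)` or `(1-x)^(M-1)`.

By `-log(1-x) ≥ 2x/(2-x)` these lie below `(1+Mx) exp(-Mx)` when `Mx > 4` and `exp(-Mx)` when `Mx >
2`. For `t = c log n / n`, `Mx` equals `nt = c log n` in the space models and `nt/2` in the plane
ones, so `c log n > 4` is the condition needed in all four cases. -/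

namespace RandomPolygon

/-! ### Gaussian weight of caps around a subspace. -/

section Gaussian

variable {V : Type*} [NormedAddCommGroup V] [InnerProductSpace ℝ V] [FiniteDimensional ℝ V]
  [MeasurableSpace V] [BorelSpace V]

theorem integrable_exp_neg_norm_sq {α : ℝ} (hα : 0 < α) :
    Integrable (fun a : V => Real.exp (-α * ‖a‖ ^ 2)) := by
  apply Integrable.of_integral_ne_zero
  rw [GaussianFourier.integral_rexp_neg_mul_sq_norm hα]
  positivity

variable (V) in
/-- The unnormalized Gaussian measure `exp (-‖a‖²) da`. -/
noncomputable def gaussianWeight : Measure V :=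
  volume.withDensity fun a => ENNReal.ofReal (Real.exp (-‖a‖ ^ 2))

theorem integrable_exp_neg_norm_sq_one : Integrable (fun a : V => Real.exp (-‖a‖ ^ 2)) := by
  simpa using integrable_exp_neg_norm_sq (V := V) one_pos

instance : IsFiniteMeasure (gaussianWeight V) :=
  isFiniteMeasure_withDensity_ofReal integrable_exp_neg_norm_sq_one.2

theorem gaussianWeight_absolutelyContinuous : gaussianWeight V ≪ volume :=
  withDensity_absolutelyContinuous _ _

theorem gaussianWeight_apply {s : Set V} (hs : MeasurableSet s) :
    gaussianWeight V s =
      ENNReal.ofReal (∫ a, s.indicator (fun a => Real.exp (-‖a‖ ^ 2)) a) := by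
  rw [gaussianWeight, withDensity_apply _ hs, integral_indicator hs,
    ofReal_integral_eq_lintegral_ofReal integrable_exp_neg_norm_sq_one.integrableOn
      (ae_of_all _ fun _ => (Real.exp_pos _).le)]

theorem gaussianWeight_univ_ne_zero : gaussianWeight V Set.univ ≠ 0 := by
  rw [gaussianWeight_apply MeasurableSet.univ, ENNReal.ofReal_ne_zero_iff, Set.indicator_univ]
  have := GaussianFourier.integral_rexp_neg_mul_sq_norm (V := V) one_pos
  rw [show (fun a : V => Real.exp (-‖a‖ ^ 2)) = fun a => Real.exp (-1 * ‖a‖ ^ 2) by simp, this]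
  positivity

/-- Radial Gaussian tail integral in dimension two. -/
theorem integral_Ioi_mul_exp_neg_sq {R : ℝ} (hR : 0 ≤ R) :
    ∫ r in Set.Ioi R, r * Real.exp (-r ^ 2) = Real.exp (-R ^ 2) / 2 := by
  have hd : ∀ r ∈ Set.Ioi R, HasDerivAt (fun r : ℝ => -Real.exp (-r ^ 2) / 2)
      (r * Real.exp (-r ^ 2)) r := fun r _ => by
    convert! (((hasDerivAt_pow 2 r).neg.exp).neg.div_const 2) using 1
    norm_num; ring
  have ht : Filter.Tendsto (fun r : ℝ => -Real.exp (-r ^ 2) / 2) Filter.atTop (nhds 0) := by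
    have h : Filter.Tendsto (fun r : ℝ => Real.exp (-r ^ 2)) Filter.atTop (nhds 0) :=
      Real.tendsto_exp_neg_atTop_nhds_zero.comp (Filter.tendsto_pow_atTop two_ne_zero)
    simpa using h.neg.div_const 2
  rw [integral_Ioi_of_hasDerivAt_of_nonneg (by fun_prop) hd
    (fun r hr => mul_nonneg (hR.trans (le_of_lt hr)) (Real.exp_pos _).le) ht]
  ring

/-- Radial Gaussian tail integral in dimension four. -/
theorem integral_Ioi_pow_three_mul_exp_neg_sq {R : ℝ} (hR : 0 ≤ R) :
    ∫ r in Set.Ioi R, r ^ 3 * Real.exp (-r ^ 2) = (1 + R ^ 2) * Real.exp (-R ^ 2) / 2 := by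
  have hd : ∀ r ∈ Set.Ioi R, HasDerivAt (fun r : ℝ => -((1 + r ^ 2) * Real.exp (-r ^ 2)) / 2)
      (r ^ 3 * Real.exp (-r ^ 2)) r := fun r _ => by
    convert! ((((hasDerivAt_pow 2 r).const_add 1).mul (hasDerivAt_pow 2 r).neg.exp).neg.div_const 2)
      using 1
    norm_num; ring
  have ht : Filter.Tendsto (fun r : ℝ => -((1 + r ^ 2) * Real.exp (-r ^ 2)) / 2) Filter.atTop
      (nhds 0) := by
    have h1 := Real.tendsto_exp_neg_atTop_nhds_zero.comp
      (Filter.tendsto_pow_atTop (α := ℝ) two_ne_zero)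
    have h2 := (Real.tendsto_pow_mul_exp_neg_atTop_nhds_zero 1).comp
      (Filter.tendsto_pow_atTop (α := ℝ) two_ne_zero)
    have h := (h1.add h2).neg.div_const 2
    simp only [add_zero, neg_zero, zero_div] at h
    refine h.congr fun r => ?_
    simp; ring
  rw [integral_Ioi_of_hasDerivAt_of_nonneg (by fun_prop) hd
    (fun r hr => mul_nonneg (pow_nonneg (hR.trans (le_of_lt hr)) _) (Real.exp_pos _).le) ht]
  ring

/-- Integrating the cap indicator over radii, for a threshold determined by `B`. -/
theorem integral_radial_cap {x B : ℝ} (hx0 : 0 ≤ x) (hx1 : x < 1) (hB : 0 ≤ B) (f : ℝ → ℝ) :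
    ∫ r in Set.Ioi (0 : ℝ), f r * (if x * (r ^ 2 + B ^ 2) ≤ r ^ 2 then Real.exp (-r ^ 2) else 0) =
      ∫ r in Set.Ioi (√(x / (1 - x)) * B), f r * Real.exp (-r ^ 2) := by
  have h1x : 0 < 1 - x := by linarith
  have hR : 0 ≤ √(x / (1 - x)) * B := by positivity
  -- The cap inequality is not strict, so it matches a closed half-line; endpoints are null.
  rw [← integral_Ici_eq_integral_Ioi, ← integral_Ici_eq_integral_Ioi,
    ← integral_indicator measurableSet_Ici, ← integral_indicator measurableSet_Ici]
  congr 1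
  ext r
  have key : 0 ≤ r → (x * (r ^ 2 + B ^ 2) ≤ r ^ 2 ↔ √(x / (1 - x)) * B ≤ r) := fun hr => by
    rw [← sq_le_sq₀ hR hr, mul_pow, Real.sq_sqrt (by positivity), div_mul_eq_mul_div,
      div_le_iff₀ h1x]
    constructor <;> intro h <;> nlinarith
  simp only [Set.indicator, Set.mem_Ici]
  by_cases hr : 0 ≤ r
  · simp [hr, key hr]
  · have : ¬ √(x / (1 - x)) * B ≤ r := fun h => hr (hR.trans h)
    simp [hr, this]

theorem measurableSet_cap (K : Submodule ℝ V) (x : ℝ) :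
    MeasurableSet {a : V | x * ‖a‖ ^ 2 ≤ ‖K.orthogonalProjectionOnto a‖ ^ 2} :=
  measurableSet_le (by fun_prop) (by fun_prop)

/-- The Gaussian weight of the cap around a subspace, as an iterated integral. -/
theorem gaussianWeight_cap_eq_integral (K : Submodule ℝ V) (x : ℝ) :
    gaussianWeight V {a | x * ‖a‖ ^ 2 ≤ ‖K.orthogonalProjectionOnto a‖ ^ 2} =
      ENNReal.ofReal (∫ b : Kᗮ, Real.exp (-‖b‖ ^ 2) *
        ∫ a : K, if x * (‖a‖ ^ 2 + ‖b‖ ^ 2) ≤ ‖a‖ ^ 2 then Real.exp (-‖a‖ ^ 2) else 0) := by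
  rw [gaussianWeight_apply (measurableSet_cap K x)]
  congr 1
  let S : Set (K × Kᗮ) := {p | x * (‖p.1‖ ^ 2 + ‖p.2‖ ^ 2) ≤ ‖p.1‖ ^ 2}
  have hS : MeasurableSet S := measurableSet_le (by fun_prop) (by fun_prop)
  let g : K × Kᗮ → ℝ := S.indicator fun p => Real.exp (-‖p.1‖ ^ 2) * Real.exp (-‖p.2‖ ^ 2)
  have hg : Integrable g (volume.prod volume) :=
    (integrable_exp_neg_norm_sq_one.mul_prod integrable_exp_neg_norm_sq_one).indicator hS
  -- The splitting of `V` into `K × Kᗮ` preserves volume, and the Gaussian density factors along it.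
  let e := K.orthogonalDecomposition
  have hpres : MeasurePreserving (fun a : V => WithLp.ofLp (e a)) volume (volume : Measure (K × Kᗮ)) :=
    (WithLp.volume_preserving_ofLp K Kᗮ).comp e.measurePreserving
  have hemb : MeasurableEmbedding (fun a : V => WithLp.ofLp (e a)) :=
    (MeasurableEquiv.toLp 2 (K × Kᗮ)).symm.measurableEmbedding.comp e.toHomeomorph.measurableEmbedding
  have h1 : ∀ a : V, ({a : V | x * ‖a‖ ^ 2 ≤ ‖K.orthogonalProjectionOnto a‖ ^ 2}).indicator
      (fun a => Real.exp (-‖a‖ ^ 2)) a = g (WithLp.ofLp (e a)) := fun a => by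
    simp only [g, S, e, Submodule.orthogonalDecomposition_apply, Set.indicator, Set.mem_ofPred_eq,
      ← Submodule.norm_sq_eq_add_norm_sq_projection, ← Real.exp_add, ← neg_add]
  rw [integral_congr_ae (ae_of_all _ h1), hpres.integral_comp hemb, Measure.volume_eq_prod,
    integral_prod_symm _ hg]
  refine integral_congr_ae (ae_of_all _ fun b => ?_)
  simp only
  rw [← integral_const_mul]
  refine integral_congr_ae (ae_of_all _ fun a => ?_)
  simp only [g, S, Set.indicator, Set.mem_ofPred_eq]
  split_ifs <;> ring

/-- Integral of a moment against a Gaussian on the half line. -/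
theorem integral_pow_mul_exp_neg_mul_sq (j : ℕ) {α : ℝ} (hα : 0 < α) :
    ∫ r in Set.Ioi (0 : ℝ), r ^ j * Real.exp (-α * r ^ 2) =
      α ^ (-((j : ℝ) + 1) / 2) * (1 / 2) * Real.Gamma (((j : ℝ) + 1) / 2) := by
  have h := integral_rpow_mul_exp_neg_mul_rpow (p := 2) (q := j) (b := α) two_pos
    (by linarith [(Nat.cast_nonneg j : (0 : ℝ) ≤ j)]) hα
  simpa only [Real.rpow_natCast, Real.rpow_two] using h

theorem integral_exp_neg_mul_norm_sq {α : ℝ} (hα : 0 < α) :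
    ∫ a : V, Real.exp (-α * ‖a‖ ^ 2) =
      α ^ (-(Module.finrank ℝ V : ℝ) / 2) * ∫ a : V, Real.exp (-‖a‖ ^ 2) := by
  have h1 := GaussianFourier.integral_rexp_neg_mul_sq_norm (V := V) one_pos
  simp only [neg_one_mul, div_one] at h1
  rw [h1, GaussianFourier.integral_rexp_neg_mul_sq_norm hα, Real.div_rpow Real.pi_pos.le hα.le,
    neg_div, Real.rpow_neg hα.le]
  ring

/-- In polar coordinates the factor `r ^ 2` raises the Gamma argument by one, and `Γ(s+1) = s Γ(s)`
at `s = dim / 2` gives the constant. The zero space is treated apart, as it has no polar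
coordinates. -/
theorem integral_norm_sq_mul_exp_neg_mul_norm_sq {α : ℝ} (hα : 0 < α) :
    ∫ a : V, ‖a‖ ^ 2 * Real.exp (-α * ‖a‖ ^ 2) =
      (Module.finrank ℝ V : ℝ) / 2 / α * ∫ a : V, Real.exp (-α * ‖a‖ ^ 2) := by
  rcases subsingleton_or_nontrivial V with hV | hV
  · have h : ∀ a : V, ‖a‖ ^ 2 * Real.exp (-α * ‖a‖ ^ 2) = 0 := fun a => by
      simp [Subsingleton.elim a 0]
    simp only [h, Module.finrank_zero_of_subsingleton, integral_zero]
    simp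
  obtain ⟨j, hj⟩ : ∃ j, Module.finrank ℝ V = j + 1 :=
    ⟨Module.finrank ℝ V - 1, (Nat.sub_add_cancel Module.finrank_pos).symm⟩
  rw [integral_fun_norm_addHaar volume (fun r => r ^ 2 * Real.exp (-α * r ^ 2)),
    integral_fun_norm_addHaar volume (fun r => Real.exp (-α * r ^ 2)), hj]
  simp only [Nat.add_sub_cancel, smul_eq_mul, ← mul_assoc, ← pow_add]
  rw [integral_pow_mul_exp_neg_mul_sq _ hα, integral_pow_mul_exp_neg_mul_sq _ hα]
  have hj0 : (0 : ℝ) < ((j : ℝ) + 1) / 2 := by positivity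
  have hG : Real.Gamma ((((j + 2 : ℕ) : ℝ) + 1) / 2) =
      ((j : ℝ) + 1) / 2 * Real.Gamma (((j : ℝ) + 1) / 2) := by
    rw [← Real.Gamma_add_one hj0.ne']
    congr 1; push_cast; ring
  have hp : α ^ (-(((j + 2 : ℕ) : ℝ) + 1) / 2) = α ^ (-((j : ℝ) + 1) / 2) / α := by
    rw [← Real.rpow_sub_one hα.ne']
    congr 1; push_cast; ring
  rw [hG, hp]
  simp only [nsmul_eq_mul]
  push_cast
  ring

/-- The Gaussian weight of a cap around a subspace, computed from the radial tail profile `h`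
on the subspace. -/
theorem gaussianWeight_cap_of_profile (K : Submodule ℝ V) {x : ℝ} (hx0 : 0 ≤ x) (hx1 : x < 1)
    {k : ℕ} (hk : Module.finrank ℝ K = k + 1) (h : ℝ → ℝ)
    (hh : ∀ R : ℝ, 0 ≤ R → ∫ r in Set.Ioi R, r ^ k * Real.exp (-r ^ 2) = h (R ^ 2) / 2)
    (h0 : h 0 = 1) :
    gaussianWeight V {a | x * ‖a‖ ^ 2 ≤ ‖K.orthogonalProjectionOnto a‖ ^ 2} =
      ENNReal.ofReal ((∫ b : Kᗮ, Real.exp (-‖b‖ ^ 2) * h (x / (1 - x) * ‖b‖ ^ 2)) /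
        ∫ b : Kᗮ, Real.exp (-‖b‖ ^ 2)) * gaussianWeight V Set.univ := by
  have : Nontrivial K := Module.nontrivial_of_finrank_pos (R := ℝ) (by omega)
  -- Half the surface area of the unit sphere of `K`; it cancels in the final quotient.
  let C : ℝ := (k + 1) * (volume : Measure K).real (Metric.ball 0 1) / 2
  have hinner : ∀ y : ℝ, 0 ≤ y → y < 1 → ∀ b : Kᗮ,
      ∫ a : K, (if y * (‖a‖ ^ 2 + ‖b‖ ^ 2) ≤ ‖a‖ ^ 2 then Real.exp (-‖a‖ ^ 2) else 0) =
        C * h (y / (1 - y) * ‖b‖ ^ 2) := fun y hy0 hy1 b => by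
    have h1y : 0 < 1 - y := by linarith
    rw [integral_fun_norm_addHaar volume
      (fun r => if y * (r ^ 2 + ‖b‖ ^ 2) ≤ r ^ 2 then Real.exp (-r ^ 2) else 0), hk]
    simp only [smul_eq_mul, Nat.add_sub_cancel]
    rw [integral_radial_cap hy0 hy1 (norm_nonneg b), hh _ (by positivity), mul_pow,
      Real.sq_sqrt (by positivity)]
    simp only [C, nsmul_eq_mul]
    push_cast
    ring
  have hcap : ∀ y : ℝ, 0 ≤ y → y < 1 →
      gaussianWeight V {a | y * ‖a‖ ^ 2 ≤ ‖K.orthogonalProjectionOnto a‖ ^ 2} =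
        ENNReal.ofReal (C * ∫ b : Kᗮ, Real.exp (-‖b‖ ^ 2) * h (y / (1 - y) * ‖b‖ ^ 2)) :=
    fun y hy0 hy1 => by
    rw [gaussianWeight_cap_eq_integral]
    simp only [hinner y hy0 hy1]
    rw [← integral_const_mul]
    congr 1
    refine integral_congr_ae (ae_of_all _ fun b => ?_)
    ring
  have huniv : gaussianWeight V Set.univ =
      ENNReal.ofReal (C * ∫ b : Kᗮ, Real.exp (-‖b‖ ^ 2)) := by
    -- The cap of height 0 is the whole space, so the total weight comes from the same formula with
    -- `h 0 = 1`.
    have := hcap 0 le_rfl one_pos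
    simp only [zero_div, zero_mul, h0, mul_one] at this
    rw [← this]
    congr 1
    ext a
    simp
  have hpos : 0 < ∫ b : Kᗮ, Real.exp (-‖b‖ ^ 2) := by
    have h1 := GaussianFourier.integral_rexp_neg_mul_sq_norm (V := Kᗮ) one_pos
    simp only [neg_one_mul, div_one] at h1
    rw [h1]; positivity
  have hC : 0 ≤ C * ∫ b : Kᗮ, Real.exp (-‖b‖ ^ 2) := by positivity
  rw [hcap x hx0 hx1, huniv, ← ENNReal.ofReal_mul' hC]
  rw [mul_comm C, mul_comm C, ← mul_assoc, div_mul_cancel₀ _ hpos.ne']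

/-- The Gaussian proportion of a cap around a plane. -/
theorem gaussianWeight_cap_two (K : Submodule ℝ V) {x : ℝ} (hx0 : 0 ≤ x) (hx1 : x < 1)
    (hk : Module.finrank ℝ K = 2) :
    gaussianWeight V {a | x * ‖a‖ ^ 2 ≤ ‖K.orthogonalProjectionOnto a‖ ^ 2} =
      ENNReal.ofReal ((1 - x) ^ ((Module.finrank ℝ Kᗮ : ℝ) / 2)) * gaussianWeight V Set.univ := by
  have h1x : 0 < 1 - x := by linarith
  rw [gaussianWeight_cap_of_profile K hx0 hx1 hk (fun s => Real.exp (-s))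
    (fun R hR => by simpa using integral_Ioi_mul_exp_neg_sq hR) (by simp)]
  have hpos : 0 < ∫ b : Kᗮ, Real.exp (-‖b‖ ^ 2) := by
    have h1 := GaussianFourier.integral_rexp_neg_mul_sq_norm (V := Kᗮ) one_pos
    simp only [neg_one_mul, div_one] at h1
    rw [h1]; positivity
  have h : ∀ b : Kᗮ, Real.exp (-‖b‖ ^ 2) * Real.exp (-(x / (1 - x) * ‖b‖ ^ 2)) =
      Real.exp (-(1 - x)⁻¹ * ‖b‖ ^ 2) := fun b => by
    rw [← Real.exp_add]; congr 1; field_simp; ring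
  simp only [h]
  rw [integral_exp_neg_mul_norm_sq (inv_pos.2 h1x), mul_div_cancel_right₀ _ hpos.ne',
    Real.inv_rpow h1x.le, neg_div, Real.rpow_neg h1x.le, inv_inv]

/-- The Gaussian proportion of a cap around a four-dimensional subspace. -/
theorem gaussianWeight_cap_four (K : Submodule ℝ V) {x : ℝ} (hx0 : 0 ≤ x) (hx1 : x < 1)
    (hk : Module.finrank ℝ K = 4) :
    gaussianWeight V {a | x * ‖a‖ ^ 2 ≤ ‖K.orthogonalProjectionOnto a‖ ^ 2} =
      ENNReal.ofReal ((1 - x) ^ ((Module.finrank ℝ Kᗮ : ℝ) / 2) *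
        (1 + (Module.finrank ℝ Kᗮ : ℝ) / 2 * x)) * gaussianWeight V Set.univ := by
  have h1x : 0 < 1 - x := by linarith
  have hα : 0 < (1 - x)⁻¹ := inv_pos.2 h1x
  rw [gaussianWeight_cap_of_profile K hx0 hx1 hk (fun s => (1 + s) * Real.exp (-s))
    (fun R hR => integral_Ioi_pow_three_mul_exp_neg_sq hR) (by simp)]
  have hpos : 0 < ∫ b : Kᗮ, Real.exp (-‖b‖ ^ 2) := by
    have h1 := GaussianFourier.integral_rexp_neg_mul_sq_norm (V := Kᗮ) one_pos
    simp only [neg_one_mul, div_one] at h1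
    rw [h1]; positivity
  -- Half of the Gaussian decay absorbs the factor `‖b‖ ^ 2`, since `s * exp (-s) ≤ 1`.
  have hint : Integrable (fun b : Kᗮ => ‖b‖ ^ 2 * Real.exp (-(1 - x)⁻¹ * ‖b‖ ^ 2)) := by
    refine Integrable.mono' ((integrable_exp_neg_norm_sq (half_pos hα)).const_mul
      ((1 - x)⁻¹ / 2)⁻¹) (by fun_prop) (ae_of_all _ fun b => ?_)
    have h2 := Real.add_one_le_exp ((1 - x)⁻¹ / 2 * ‖b‖ ^ 2)
    rw [Real.norm_of_nonneg (by positivity), ← div_eq_inv_mul, le_div_iff₀ (half_pos hα),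
      show -(1 - x)⁻¹ * ‖b‖ ^ 2 = -((1 - x)⁻¹ / 2 * ‖b‖ ^ 2) + -((1 - x)⁻¹ / 2) * ‖b‖ ^ 2 by ring,
      Real.exp_add, Real.exp_neg]
    have h3 := Real.exp_pos ((1 - x)⁻¹ / 2 * ‖b‖ ^ 2)
    have h4 := Real.exp_pos (-((1 - x)⁻¹ / 2) * ‖b‖ ^ 2)
    calc _ = ((1 - x)⁻¹ / 2 * ‖b‖ ^ 2) * (Real.exp ((1 - x)⁻¹ / 2 * ‖b‖ ^ 2))⁻¹ *
          Real.exp (-((1 - x)⁻¹ / 2) * ‖b‖ ^ 2) := by ring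
      _ ≤ 1 * Real.exp (-((1 - x)⁻¹ / 2) * ‖b‖ ^ 2) := by
        gcongr
        rw [← div_eq_mul_inv, div_le_one h3]
        linarith
      _ = _ := one_mul _
  have h : ∀ b : Kᗮ, Real.exp (-‖b‖ ^ 2) *
      ((1 + x / (1 - x) * ‖b‖ ^ 2) * Real.exp (-(x / (1 - x) * ‖b‖ ^ 2))) =
      Real.exp (-(1 - x)⁻¹ * ‖b‖ ^ 2) +
        x / (1 - x) * (‖b‖ ^ 2 * Real.exp (-(1 - x)⁻¹ * ‖b‖ ^ 2)) := fun b => by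
    rw [show -(1 - x)⁻¹ * ‖b‖ ^ 2 = -‖b‖ ^ 2 + -(x / (1 - x) * ‖b‖ ^ 2) by field_simp; ring,
      Real.exp_add]
    ring
  simp only [h]
  rw [integral_add (integrable_exp_neg_norm_sq hα) (hint.const_mul _), integral_const_mul,
    integral_norm_sq_mul_exp_neg_mul_norm_sq hα, integral_exp_neg_mul_norm_sq hα,
    Real.inv_rpow h1x.le, neg_div, Real.rpow_neg h1x.le, inv_inv]
  congr 2
  field_simp

/-- A cap of full height around a proper subspace is null. -/
theorem gaussianWeight_cap_one (K : Submodule ℝ V) (hK : K ≠ ⊤) {x : ℝ} (hx : 1 ≤ x) :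
    gaussianWeight V {a | x * ‖a‖ ^ 2 ≤ ‖K.orthogonalProjectionOnto a‖ ^ 2} = 0 := by
  refine gaussianWeight_absolutelyContinuous
    (measure_mono_null (fun a ha => ?_) (Measure.addHaar_submodule volume K hK))
  have h1 := Submodule.norm_sq_eq_add_norm_sq_projection a K
  have h2 : x * ‖a‖ ^ 2 ≤ ‖K.orthogonalProjectionOnto a‖ ^ 2 := ha
  have h3 : Kᗮ.orthogonalProjectionOnto a = 0 := by
    rw [← norm_eq_zero, ← sq_eq_zero_iff]
    nlinarith [sq_nonneg ‖a‖, sq_nonneg ‖Kᗮ.orthogonalProjectionOnto a‖]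
  rw [Submodule.orthogonalProjectionOnto_eq_zero_iff, Submodule.orthogonal_orthogonal] at h3
  exact h3

/-- A cap of height beyond the radius is null. -/
theorem gaussianWeight_cap_of_one_lt [Nontrivial V] (K : Submodule ℝ V) {x : ℝ} (hx : 1 < x) :
    gaussianWeight V {a | x * ‖a‖ ^ 2 ≤ ‖K.orthogonalProjectionOnto a‖ ^ 2} = 0 := by
  refine gaussianWeight_absolutelyContinuous
    (measure_mono_null (t := {0}) (fun a ha => ?_) (measure_singleton 0))
  have h1 := Submodule.norm_sq_eq_add_norm_sq_projection a K
  have h2 : x * ‖a‖ ^ 2 ≤ ‖K.orthogonalProjectionOnto a‖ ^ 2 := ha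
  have h3 : ‖a‖ ^ 2 = 0 := by
    nlinarith [sq_nonneg ‖a‖, sq_nonneg ‖Kᗮ.orthogonalProjectionOnto a‖]
  simpa using h3

/-- The squared projection onto the span of an orthonormal family. -/
theorem sum_inner_sq_eq_norm_sq_projection {ι : Type*} [Fintype ι] {w : ι → V}
    (hw : Orthonormal ℝ w) (a : V) :
    ∑ j, inner ℝ (w j) a ^ 2 =
      ‖(Submodule.span ℝ (Set.range w)).orthogonalProjectionOnto a‖ ^ 2 := by
  set K := Submodule.span ℝ (Set.range w)
  have hmem : ∀ j, w j ∈ K := fun j => Submodule.subset_span ⟨j, rfl⟩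
  have happ : ∀ j, Module.Basis.span hw.linearIndependent j = (⟨w j, hmem j⟩ : K) := 
    Module.Basis.span_apply hw.linearIndependent
  let b : OrthonormalBasis ι ℝ K :=
    (Module.Basis.span hw.linearIndependent).toOrthonormalBasis (by
      rw [← K.subtypeₗᵢ.orthonormal_comp_iff]
      convert hw using 1
      ext j
      simp [happ])
  rw [← b.sum_sq_norm_inner_right]
  refine Finset.sum_congr rfl fun j _ => ?_
  rw [Real.norm_eq_abs, sq_abs, show b j = ⟨w j, hmem j⟩ by simp [b, happ],
    Submodule.inner_orthogonalProjectionOnto_eq_of_mem_left]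

end Gaussian

/-! ### Comparison of cap proportions with exponentials. -/

section GaussianBounds

/-- This is `2y/(y+2) ≤ log(1+y)` at `y = x/(1-x)`, where `1 + y = 1/(1-x)`. The cruder `x ≤
-log(1-x)` could not make up for the exponent `M - s` replacing `M`. -/
theorem two_mul_div_le_neg_log_one_sub {x : ℝ} (hx0 : 0 ≤ x) (hx1 : x < 1) :
    2 * x / (2 - x) ≤ -Real.log (1 - x) := by
  have h1x : 0 < 1 - x := by linarith
  have h := Real.le_log_one_add_of_nonneg (x := x / (1 - x)) (by positivity)
  have h1 : 1 + x / (1 - x) = (1 - x)⁻¹ := by field_simp; ring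
  have h2 : 2 * (x / (1 - x)) / (x / (1 - x) + 2) = 2 * x / (2 - x) := by
    have : 2 - x ≠ 0 := by linarith
    have : x + (1 - x) * 2 ≠ 0 := by linarith
    field_simp
    ring
  rwa [h1, h2, Real.log_inv] at h

/-- After clearing denominators, `Mx ≤ (M-s) 2x/(2-x)` is exactly `2s ≤ Mx`. In the applications `s`
is half the dimension of the subspace. -/
theorem one_sub_rpow_le_exp {x M s : ℝ} (hx0 : 0 < x) (hx1 : x < 1) (hs : 0 ≤ M - s)
    (h : 2 * s ≤ M * x) : (1 - x) ^ (M - s) ≤ Real.exp (-(M * x)) := by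
  rw [Real.rpow_def_of_pos (by linarith), Real.exp_le_exp]
  have h1 := mul_le_mul_of_nonneg_right (two_mul_div_le_neg_log_one_sub hx0.le hx1) hs
  have h2 : M * x ≤ 2 * x / (2 - x) * (M - s) := by
    rw [div_mul_eq_mul_div, le_div_iff₀ (by linarith)]
    nlinarith
  linarith

theorem one_sub_rpow_lt_exp {x M s : ℝ} (hx0 : 0 < x) (hx1 : x < 1) (hs : 0 ≤ M - s)
    (h : 2 * s < M * x) : (1 - x) ^ (M - s) < Real.exp (-(M * x)) := by
  rw [Real.rpow_def_of_pos (by linarith), Real.exp_lt_exp]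
  have h1 := mul_le_mul_of_nonneg_right (two_mul_div_le_neg_log_one_sub hx0.le hx1) hs
  have h2 : M * x < 2 * x / (2 - x) * (M - s) := by
    rw [div_mul_eq_mul_div, lt_div_iff₀ (by linarith)]
    nlinarith
  linarith

variable (V : Type*) [NormedAddCommGroup V] [InnerProductSpace ℝ V] [FiniteDimensional ℝ V]
  [MeasurableSpace V] [BorelSpace V]

/-- At height one the cap is the span itself, which is null only if proper; above height one it is
just the origin. Hence the dimension condition only for `x = 1`. -/
theorem gaussianWeight_cap_eq_zero_of_orthonormal {k : ℕ} [NeZero k] {x : ℝ} (hx : 1 ≤ x)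
    (hk : x = 1 → k < Module.finrank ℝ V) {w : Fin k → V} (hw : Orthonormal ℝ w) :
    gaussianWeight V {a | x * ‖a‖ ^ 2 ≤ ∑ j, inner ℝ (w j) a ^ 2} = 0 := by
  simp only [sum_inner_sq_eq_norm_sq_projection hw]
  rcases hx.eq_or_lt with h | h
  · refine gaussianWeight_cap_one _ (fun htop => ?_) hx
    have h1 := finrank_span_eq_card hw.linearIndependent
    rw [htop, finrank_top, Fintype.card_fin] at h1
    have := hk h.symm
    omega
  · have : Nontrivial V := ⟨w 0, 0, hw.ne_zero 0⟩
    exact gaussianWeight_cap_of_one_lt _ h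

/-- The Gaussian proportion of a tall cap around a plane is less than `exp (-M x)`, where `M` is
half the dimension. -/
theorem exists_gaussianWeight_cap_two_bound {M x : ℝ} (hM : (Module.finrank ℝ V : ℝ) = 2 * M)
    (hx : 0 < x) (hMx : 2 < M * x) :
    ∃ p < ENNReal.ofReal (Real.exp (-(M * x))), ∀ w : Fin 2 → V, Orthonormal ℝ w →
      gaussianWeight V {a | x * ‖a‖ ^ 2 ≤ ∑ j, inner ℝ (w j) a ^ 2} ≤
        p * gaussianWeight V Set.univ := by
  rcases lt_or_ge x 1 with hx1 | hx1
  · have hM2 : 2 < M := by nlinarith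
    -- The bound `p` is chosen independently of `w`, so that the strict inequality survives
    -- averaging over the model.
    refine ⟨ENNReal.ofReal ((1 - x) ^ (M - 1)),
      (ENNReal.ofReal_lt_ofReal_iff (Real.exp_pos _)).2
        (one_sub_rpow_lt_exp hx hx1 (by linarith) (by linarith)), fun w hw => ?_⟩
    have hk := finrank_span_eq_card hw.linearIndependent
    simp only [sum_inner_sq_eq_norm_sq_projection hw]
    set K := Submodule.span ℝ (Set.range w)
    have hK : (Module.finrank ℝ K : ℝ) + Module.finrank ℝ Kᗮ = Module.finrank ℝ V := by
      exact_mod_cast K.finrank_add_finrank_orthogonal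
    rw [Fintype.card_fin] at hk
    rw [gaussianWeight_cap_two K hx.le hx1 hk,
      show (Module.finrank ℝ Kᗮ : ℝ) / 2 = M - 1 by rw [hk] at hK; push_cast at hK; linarith]
  · refine ⟨0, ENNReal.ofReal_pos.2 (Real.exp_pos _), fun w hw => ?_⟩
    rw [gaussianWeight_cap_eq_zero_of_orthonormal V hx1 (fun h => ?_) hw]
    · simp
    · have : ((2 : ℕ) : ℝ) < Module.finrank ℝ V := by rw [hM]; subst h; push_cast; linarith
      exact_mod_cast this

/-- The Gaussian proportion of a tall cap around a four-dimensional subspace is less than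
`(1 + M x) exp (-M x)`, where `M` is half the dimension. -/
theorem exists_gaussianWeight_cap_four_bound {M x : ℝ} (hM : (Module.finrank ℝ V : ℝ) = 2 * M)
    (hx : 0 < x) (hMx : 4 < M * x) :
    ∃ p < ENNReal.ofReal ((1 + M * x) * Real.exp (-(M * x))),
      ∀ w : Fin 4 → V, Orthonormal ℝ w →
        gaussianWeight V {a | x * ‖a‖ ^ 2 ≤ ∑ j, inner ℝ (w j) a ^ 2} ≤
          p * gaussianWeight V Set.univ := by
  have hpos : 0 < (1 + M * x) * Real.exp (-(M * x)) :=
    mul_pos (by linarith) (Real.exp_pos _)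
  rcases lt_or_ge x 1 with hx1 | hx1
  · have hM4 : 4 < M := by nlinarith
    refine ⟨ENNReal.ofReal ((1 - x) ^ (M - 2) * (1 + (M - 2) * x)),
      (ENNReal.ofReal_lt_ofReal_iff hpos).2 ?_, fun w hw => ?_⟩
    -- Strictness comes from the polynomial factor, as `M - 2 < M`.
    · have h1 := one_sub_rpow_le_exp (s := 2) hx hx1 (by linarith : 0 ≤ M - 2) (by linarith)
      have h2 : 0 < 1 + (M - 2) * x := by nlinarith
      calc _ ≤ Real.exp (-(M * x)) * (1 + (M - 2) * x) := by gcongr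
        _ < Real.exp (-(M * x)) * (1 + M * x) := by gcongr; linarith
        _ = _ := mul_comm _ _
    · have hk := finrank_span_eq_card hw.linearIndependent
      simp only [sum_inner_sq_eq_norm_sq_projection hw]
      set K := Submodule.span ℝ (Set.range w)
      have hK : (Module.finrank ℝ K : ℝ) + Module.finrank ℝ Kᗮ = Module.finrank ℝ V := by
        exact_mod_cast K.finrank_add_finrank_orthogonal
      rw [Fintype.card_fin] at hk
      rw [gaussianWeight_cap_four K hx.le hx1 hk,
        show (Module.finrank ℝ Kᗮ : ℝ) / 2 = M - 2 by rw [hk] at hK; push_cast at hK; linarith]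
  · refine ⟨0, ENNReal.ofReal_pos.2 hpos, fun w hw => ?_⟩
    rw [gaussianWeight_cap_eq_zero_of_orthonormal V hx1 (fun h => ?_) hw]
    · simp
    · have : ((4 : ℕ) : ℝ) < Module.finrank ℝ V := by rw [hM]; subst h; push_cast; linarith
      exact_mod_cast this

end GaussianBounds

/-! ### Exchange of the random point and the random direction. -/

section Averaging

variable {V : Type*} [NormedAddCommGroup V] [InnerProductSpace ℝ V] [FiniteDimensional ℝ V]
  [MeasurableSpace V] [BorelSpace V]

/-- Since `⊤⁻¹ = 0`, infinite mass normalizes to the zero measure and tail bounds become trivial. So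
nothing need be known about `d`. -/
theorem normalizedVolume_of_eq_top {n : ℕ} {M : Set (QuatSpace n)} {d : ℝ}
    (h : (μH[d] : Measure M) Set.univ = ⊤) : normalizedVolume M d = 0 := by
  simp [normalizedVolume, h]

/-- Averaging over Gaussian directions `a`: if the isometries of `M` carry the statistic `F a` to
the square norm of the `i`-th coordinate, then the tail of the latter under the normalized volume
is controlled by the Gaussian tail of `F · q`, for any `q ∈ M`. -/
theorem normalizedVolume_tail_le {n : ℕ} {M : Set (QuatSpace n)} (d : ℝ) (i : Fin n)
    {F : V → QuatSpace n → ℝ} (hF : Continuous fun z : V × QuatSpace n => F z.1 z.2)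
    (hiso : ∀ a : V, a ≠ 0 → ∃ φ : M ≃ᵢ M, ∀ q : M, F a q = ‖a‖ ^ 2 * ‖(φ q).1 i‖ ^ 2)
    [Nontrivial V] {t : ℝ} {p : ENNReal}
    (hp : ∀ q ∈ M, gaussianWeight V {a | t * ‖a‖ ^ 2 ≤ F a q} ≤ p * gaussianWeight V Set.univ) :
    normalizedVolume M d {q | t ≤ ‖q.1 i‖ ^ 2} ≤ p := by
  rcases eq_or_ne ((μH[d] : Measure M) Set.univ) ⊤ with htop | htop
  · simp [normalizedVolume_of_eq_top htop]
  set μ : Measure M := μH[d] with hμ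
  have : IsFiniteMeasure μ := ⟨htop.lt_top⟩
  set γ := gaussianWeight V
  let S : Set M := {q | t ≤ ‖q.1 i‖ ^ 2}
  have hS : MeasurableSet S := by
    have : Continuous fun q : M => ‖q.1 i‖ ^ 2 := by fun_prop
    exact measurableSet_le measurable_const this.measurable
  let T : Set (V × M) := {z | t * ‖z.1‖ ^ 2 ≤ F z.1 z.2}
  have hT : MeasurableSet T := by
    have h1 : Continuous fun z : V × M => F z.1 z.2 :=
      hF.comp (continuous_fst.prodMk (continuous_subtype_val.comp continuous_snd))
    have h2 : Continuous fun z : V × M => t * ‖z.1‖ ^ 2 := by fun_prop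
    exact measurableSet_le h2.measurable h1.measurable
  -- All slices over `a ≠ 0` are isometric preimages of `S`; evaluating the product measure of `T`
  -- in both orders then compares `μ S` with the Gaussian bound.
  have hslice : ∀ a : V, a ≠ 0 → μ (Prod.mk a ⁻¹' T) = μ S := fun a ha => by
    obtain ⟨φ, hφ⟩ := hiso a ha
    have hpre : Prod.mk a ⁻¹' T = φ ⁻¹' S := by
      ext q
      have ha2 : 0 < ‖a‖ ^ 2 := by positivity
      simp only [T, S, Set.mem_preimage, Set.mem_ofPred_eq, hφ]
      rw [mul_comm, mul_le_mul_iff_right₀ ha2]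
    rw [hpre, hμ, φ.hausdorffMeasure_preimage]
  have hne : ∀ᵐ a ∂γ, a ≠ 0 := by
    refine gaussianWeight_absolutelyContinuous.ae_le ?_
    exact Measure.ae_ne volume 0
  have h1 : (γ.prod μ) T = μ S * γ Set.univ := by
    rw [Measure.prod_apply hT, lintegral_congr_ae (hne.mono hslice), lintegral_const]
  have h2 : (γ.prod μ) T ≤ p * γ Set.univ * μ Set.univ := by
    rw [Measure.prod_apply_symm hT, ← lintegral_const]
    exact lintegral_mono fun q => hp q.1 q.2
  have h3 : μ S ≤ p * μ Set.univ := by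
    rw [h1, mul_right_comm] at h2
    exact (ENNReal.mul_le_mul_iff_left gaussianWeight_univ_ne_zero (measure_ne_top γ _)).1 h2
  rw [normalizedVolume, Measure.smul_apply, smul_eq_mul]
  change (μ Set.univ)⁻¹ * μ S ≤ p
  rcases eq_or_ne (μ Set.univ) 0 with h0 | h0
  · rw [measure_mono_null (Set.subset_univ S) h0, mul_zero]
    exact zero_le
  · rw [mul_comm, ← div_eq_mul_inv]
    exact ENNReal.div_le_of_le_mul h3

end Averaging

/-! ### Quaternionic Householder reflections. -/

section Reflection

variable {n : ℕ}

/-- The standard quaternion-valued Hermitian form on `ℍⁿ`. -/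
noncomputable def quatForm (a q : QuatSpace n) : ℍ[ℝ] := ∑ l, star (a l) * q l

theorem star_mul_self_quat (x : ℍ[ℝ]) : star x * x = ((‖x‖ ^ 2 : ℝ) : ℍ[ℝ]) := by
  rw [Quaternion.star_mul_self, Quaternion.normSq_eq_norm_mul_self, sq]

theorem quatForm_self (q : QuatSpace n) : quatForm q q = ((‖q‖ ^ 2 : ℝ) : ℍ[ℝ]) := by
  rw [quatForm, PiLp.norm_sq_eq_of_L2, Finset.sum_congr rfl fun l _ => star_mul_self_quat (q l)]
  exact (map_sum (algebraMap ℝ ℍ[ℝ]) _ _).symm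

theorem star_quatForm (a q : QuatSpace n) : star (quatForm a q) = quatForm q a := by
  simp [quatForm, star_sum]

theorem quatForm_sub_right (a q q' : QuatSpace n) :
    quatForm a (q - q') = quatForm a q - quatForm a q' := by
  simp [quatForm, mul_sub]

theorem quatForm_sub_left (a a' q : QuatSpace n) :
    quatForm (a - a') q = quatForm a q - quatForm a' q := by
  simp [quatForm, sub_mul]

theorem quatForm_smul_left (c : ℝ) (a q : QuatSpace n) :
    quatForm (c • a) q = c • quatForm a q := by
  simp [quatForm, Finset.smul_sum]

theorem inner_eq_re_quatForm (a q : QuatSpace n) : inner ℝ a q = (quatForm a q).re := by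
  have h : (quatForm a q).re = ∑ l, (star (a l) * q l).re :=
    map_sum (QuaternionAlgebra.reₗ _ _ _) _ _
  rw [h, PiLp.inner_apply]
  exact Finset.sum_congr rfl fun l _ => by rw [Quaternion.inner_def]; simp

/-- The quaternionic Householder reflection in the hyperplane orthogonal to `w`. -/
noncomputable def reflect (w q : QuatSpace n) : QuatSpace n :=
  WithLp.toLp 2 fun l => q l - w l * (((2 / ‖w‖ ^ 2 : ℝ) : ℍ[ℝ]) * quatForm w q)

theorem reflect_apply (w q : QuatSpace n) (l : Fin n) :
    reflect w q l = q l - w l * (((2 / ‖w‖ ^ 2 : ℝ) : ℍ[ℝ]) * quatForm w q) := rfl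

theorem reflect_sub (w q q' : QuatSpace n) :
    reflect w (q - q') = reflect w q - reflect w q' := by
  ext l : 1
  simp only [reflect_apply, PiLp.sub_apply, quatForm_sub_right]
  noncomm_ring

/-- With `r = ‖w‖ ^ 2`, this cancellation makes `reflect w` an isometric involution. It covers `w =
0` too: there `2 / 0 = 0` and the reflection is the identity. -/
theorem two_div_mul_self_mul_two_div (r : ℝ) : 2 / r * r * (2 / r) = 2 / r + 2 / r := by
  rcases eq_or_ne r 0 with h | h
  · simp [h]
  · field_simp
    norm_num

theorem reflect_reflect (w q : QuatSpace n) : reflect w (reflect w q) = q := by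
  set c : ℝ := 2 / ‖w‖ ^ 2 with hc
  have h1 : quatForm w (reflect w q) =
      quatForm w q - quatForm w w * ((c : ℍ[ℝ]) * quatForm w q) := by
    simp only [quatForm, reflect_apply, mul_sub, Finset.sum_sub_distrib, Finset.sum_mul, mul_assoc]
    rfl
  have h2 : ((c : ℍ[ℝ])) * quatForm w (reflect w q) = -((c : ℍ[ℝ]) * quatForm w q) := by
    have h3 := two_div_mul_self_mul_two_div (‖w‖ ^ 2)
    rw [← hc] at h3
    rw [h1, quatForm_self, mul_sub, ← mul_assoc, ← mul_assoc, ← Quaternion.coe_mul,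
      ← Quaternion.coe_mul, h3]
    push_cast
    noncomm_ring
  ext l : 1
  rw [reflect_apply, ← hc, h2, reflect_apply, ← hc]
  noncomm_ring

/-- All coordinates of `w` and their conjugates commute with `z`. -/
def CommutesWith (z : ℍ[ℝ]) (w : QuatSpace n) : Prop :=
  ∀ l, z * w l = w l * z ∧ z * star (w l) = star (w l) * z

/-- Reflections whose vector commutes with `z` preserve the quadratic form defined by `z`. -/
theorem sum_star_mul_mul_reflect {z : ℍ[ℝ]} {w : QuatSpace n} (hw : CommutesWith z w)
    (q : QuatSpace n) :
    ∑ l, star (reflect w q l) * z * reflect w q l = ∑ l, star (q l) * z * q l := by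
  set c : ℝ := 2 / ‖w‖ ^ 2 with hc
  set h := quatForm w q with hh
  -- Moving `z` past `w l` and its conjugate makes each correction sum to a multiple of `star h * z
  -- * h`; the coefficients `-c`, `-c` and `c ‖w‖² c = 2c` cancel.
  have h1 : ∀ l, star (reflect w q l) * z * reflect w q l = star (q l) * z * q l
      - star (q l) * w l * (z * (c * h)) - (c * star h * z) * (star (w l) * q l)
      + (c * star h * z) * (star (w l) * w l) * (c * h) := fun l => by
    rw [reflect_apply, ← hc, ← hh]
    have e1 := (hw l).1
    have e2 := (hw l).2
    have e3 : star h * (c : ℍ[ℝ]) = c * star h := (Quaternion.coe_commutes c _).symm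
    simp only [star_sub, star_mul, Quaternion.star_coe, e3]
    have e4 : star (q l) * z * (w l * (c * h)) = star (q l) * w l * (z * (c * h)) := by
      rw [mul_assoc, ← mul_assoc z, e1]; simp only [mul_assoc]
    have e5 : ∀ y, c * star h * star (w l) * z * y = (c * star h * z) * (star (w l) * y) :=
      fun y => by rw [mul_assoc (c * star h), ← e2]; simp only [mul_assoc]
    rw [sub_mul, mul_sub, sub_mul, sub_mul, e4, e5, e5]
    noncomm_ring
  have e6 : ∑ l, star (q l) * w l = star h := by rw [hh, star_quatForm]; rfl
  have e7 : ∑ l, star (w l) * q l = h := rfl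
  have e8 : ∑ l, star (w l) * w l = ((‖w‖ ^ 2 : ℝ) : ℍ[ℝ]) := quatForm_self w
  rw [Finset.sum_congr rfl fun l _ => h1 l, Finset.sum_add_distrib, Finset.sum_sub_distrib,
    Finset.sum_sub_distrib, ← Finset.sum_mul, ← Finset.mul_sum, ← Finset.sum_mul, ← Finset.mul_sum,
    e6, e7, e8]
  have h3 := two_div_mul_self_mul_two_div (‖w‖ ^ 2)
  rw [← hc] at h3
  have e9 : ∀ (r : ℝ) (x : ℍ[ℝ]), (r : ℍ[ℝ]) * x = r • x := Quaternion.coe_mul_eq_smul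
  have e10 : ∀ (r : ℝ) (x : ℍ[ℝ]), x * (r : ℍ[ℝ]) = r • x := Quaternion.mul_coe_eq_smul
  simp only [e9, e10, smul_mul_assoc, mul_smul_comm, smul_smul]
  rw [show c * (‖w‖ ^ 2 * c) = c + c by linarith, add_smul]
  simp only [mul_assoc]
  abel

/-- The case `z = 1`, which commutes with every `w`. -/
theorem norm_reflect (w q : QuatSpace n) : ‖reflect w q‖ = ‖q‖ := by
  have h := sum_star_mul_mul_reflect (z := 1) (w := w) (fun l => by simp) q
  simp only [mul_one] at h
  have h2 : quatForm (reflect w q) (reflect w q) = quatForm q q := h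
  rw [quatForm_self, quatForm_self, Quaternion.coe_inj] at h2
  exact (sq_eq_sq₀ (norm_nonneg _) (norm_nonneg _)).1 h2

/-- The signs `ε = 1` and `ε = -1`, with `z = quatJ`, treat the two components of the plane models
at once. -/
theorem reflect_commute {z : ℍ[ℝ]} {w q : QuatSpace n} (hw : CommutesWith z w) {ε : ℝ}
    (hq : ∀ l, z * q l = ε • (q l * z)) (l : Fin n) :
    z * reflect w q l = ε • (reflect w q l * z) := by
  have h : z * quatForm w q = ε • (quatForm w q * z) := by
    simp only [quatForm, Finset.mul_sum, Finset.sum_mul, Finset.smul_sum]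
    refine Finset.sum_congr rfl fun l _ => ?_
    rw [← mul_assoc, (hw l).2, mul_assoc, hq l, mul_smul_comm, mul_assoc]
  rw [reflect_apply, mul_sub, hq l, sub_mul, smul_sub, ← mul_assoc, (hw l).1, mul_assoc,
    ← mul_assoc z, ← Quaternion.coe_commutes, mul_assoc, h]
  simp only [mul_smul_comm, mul_assoc]

/-- A reflection preserving `M` acts on `M` by an isometry. -/
noncomputable def reflectOn (M : Set (QuatSpace n)) (w : QuatSpace n)
    (hM : ∀ q ∈ M, reflect w q ∈ M) : M ≃ᵢ M :=
  IsometryEquiv.mk' (fun q => ⟨reflect w q, hM q q.2⟩) (fun q => ⟨reflect w q, hM q q.2⟩)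
    (fun q => Subtype.ext (reflect_reflect w q))
    (Isometry.of_dist_eq fun q q' => by
      rw [Subtype.dist_eq, Subtype.dist_eq, dist_eq_norm, dist_eq_norm, ← reflect_sub,
        norm_reflect])

/-- A Householder reflection interchanges two unit vectors `a'`, `e` along `a' - e` only when `⟨a',
e⟩` is real. So `a` is first multiplied on the right by a unit quaternion making its `i`-th
coordinate real, which leaves `‖⟨a, q⟩‖` unchanged; then the `i`-th coordinate of the reflected `q`
is `⟨a', q⟩`. -/
theorem exists_reflect_of_norm_eq_one {a : QuatSpace n} (ha : ‖a‖ = 1) (i : Fin n) :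
    ∃ w : QuatSpace n, (∀ z, CommutesWith z a → CommutesWith z w) ∧
      ∀ q, ‖reflect w q i‖ = ‖quatForm a q‖ := by
  -- `s` is the phase of `a i`, or 1 if `a i = 0`; being a real multiple of `a i` or 1, it inherits
  -- the commutation relations of `a`.
  obtain ⟨s, r, hs, hsr, hsc⟩ : ∃ (s : ℍ[ℝ]) (r : ℝ), ‖s‖ = 1 ∧ a i * star s = (r : ℍ[ℝ]) ∧
      ∀ z, CommutesWith z a → z * s = s * z ∧ z * star s = star s * z := by
    by_cases h : a i = 0
    · exact ⟨1, 0, by simp, by simp [h], by simp⟩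
    · have hn : ‖a i‖ ≠ 0 := norm_ne_zero_iff.2 h
      refine ⟨‖a i‖⁻¹ • a i, ‖a i‖, by simp [norm_smul, hn], ?_, fun z hz => ?_⟩
      · rw [Quaternion.star_smul, mul_smul_comm, Quaternion.self_mul_star, Quaternion.normSq_eq_norm_mul_self]
        rw [← Quaternion.coe_smul, smul_eq_mul, inv_mul_cancel_left₀ hn]
      · simp only [Quaternion.star_smul, mul_smul_comm, smul_mul_assoc, (hz i).1, (hz i).2, and_self]
  let a' : QuatSpace n := WithLp.toLp 2 fun l => a l * star s
  let e : QuatSpace n := WithLp.toLp 2 (Pi.single i 1)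
  have ha'q : ∀ q, quatForm a' q = s * quatForm a q := fun q => by
    simp [quatForm, a', Finset.mul_sum, mul_assoc]
  have heq : ∀ q, quatForm e q = q i := fun q => by
    rw [quatForm, Finset.sum_eq_single i]
    · simp [e]
    · intro b _ hb
      simp [e, hb]
    · simp
  have hww : ‖a' - e‖ ^ 2 = 2 - 2 * r := by
    have hst : a' i = (r : ℍ[ℝ]) := hsr
    have h1 : quatForm a' e = (r : ℍ[ℝ]) := by
      rw [← star_quatForm, heq, hst, Quaternion.star_coe]
    have h2 : quatForm a' a' = 1 := by
      have : ‖a'‖ ^ 2 = ‖a‖ ^ 2 := by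
        rw [PiLp.norm_sq_eq_of_L2, PiLp.norm_sq_eq_of_L2]
        simp [a', hs]
      rw [quatForm_self, this, ha]; simp
    have h3 := quatForm_self (a' - e)
    rw [quatForm_sub_left, quatForm_sub_right, quatForm_sub_right, heq, heq, h1, h2, hst] at h3
    have hei : e i = ((1 : ℝ) : ℍ[ℝ]) := by simp [e]
    rw [hei, ← Quaternion.coe_one] at h3
    norm_cast at h3
    rw [Quaternion.coe_inj] at h3
    linarith
  refine ⟨a' - e, fun z hz l => ?_, fun q => ?_⟩
  · have h1 : z * e l = e l * z ∧ z * star (e l) = star (e l) * z := by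
      by_cases h : l = i
      · subst h; simp [e]
      · simp [e, h]
    obtain ⟨h2, h3⟩ := hsc z hz
    obtain ⟨h4, h5⟩ := hz l
    constructor
    · simp only [PiLp.sub_apply, mul_sub, sub_mul, h1.1, a']
      rw [← mul_assoc, h4, mul_assoc, h3, mul_assoc]
    · simp only [PiLp.sub_apply, star_sub, mul_sub, sub_mul, h1.2, a', star_mul, star_star]
      rw [← mul_assoc, h2, mul_assoc, h5, mul_assoc]
  · have hkey : reflect (a' - e) q i = s * quatForm a q := by
      have hq : quatForm (a' - e) q = s * quatForm a q - q i := by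
        rw [quatForm_sub_left, ha'q, heq]
      have hi : (a' - e) i = ((r - 1 : ℝ) : ℍ[ℝ]) := by
        rw [PiLp.sub_apply, show a' i = (r : ℍ[ℝ]) from hsr]
        simp [e]
      by_cases hr : r = 1
      · have hw : a' - e = 0 := by
          rw [← norm_eq_zero, ← sq_eq_zero_iff, hww, hr]; norm_num
        rw [reflect_apply, hq]
        rw [hw] at hq ⊢
        have : s * quatForm a q = q i := by
          rw [← sub_eq_zero, ← hq]; simp [quatForm]
        simp [this]
      · have hr1 : 1 - r ≠ 0 := fun h => hr (by linarith)
        have hc : (r - 1) * (2 / (2 - 2 * r)) = -1 := by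
          rw [show 2 - 2 * r = 2 * (1 - r) by ring]
          field_simp
          ring
        rw [reflect_apply, hq, hi, hww, ← mul_assoc, ← Quaternion.coe_mul, hc]
        push_cast
        noncomm_ring
    rw [hkey, norm_mul, hs, one_mul]

/-- For a nonzero `a`, some reflection commuting with everything `a` commutes with moves the
statistic `‖⟨a, q⟩‖` to the `i`-th coordinate. -/
theorem exists_reflectOn {M : Set (QuatSpace n)} {a : QuatSpace n} (ha : a ≠ 0)
    (hM : ∀ w, (∀ z, CommutesWith z a → CommutesWith z w) → ∀ q ∈ M, reflect w q ∈ M)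
    (i : Fin n) :
    ∃ φ : M ≃ᵢ M, ∀ q : M, ‖quatForm a q‖ ^ 2 = ‖a‖ ^ 2 * ‖(φ q).1 i‖ ^ 2 := by
  have hn : ‖a‖ ≠ 0 := norm_ne_zero_iff.2 ha
  obtain ⟨w, hw, hq⟩ := exists_reflect_of_norm_eq_one (a := ‖a‖⁻¹ • a)
    (by rw [norm_smul, norm_inv, norm_norm, inv_mul_cancel₀ hn]) i
  have hMw := hM w fun z hz => hw z fun l => by simp [(hz l).1, (hz l).2]
  refine ⟨reflectOn M w hMw, fun q => ?_⟩
  · have h : ‖(reflectOn M w hMw q).1 i‖ = _ := hq q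
    rw [h, quatForm_smul_left, norm_smul, norm_inv, norm_norm]
    field_simp

end Reflection

/-! ### Reflection invariance of the model spaces. -/

section Models

variable {n : ℕ}

theorem mem_modelArm3_iff {q : QuatSpace n} : q ∈ modelArm3 n ↔ ‖q‖ = √2 := by
  simp [modelArm3]

theorem norm_sq_quatSpace (q : QuatSpace n) : ‖q‖ ^ 2 =
    ∑ l, ((q l).re ^ 2 + (q l).imI ^ 2 + (q l).imJ ^ 2 + (q l).imK ^ 2) := by
  rw [PiLp.norm_sq_eq_of_L2]
  exact Finset.sum_congr rfl fun l _ => norm_sq_quat _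

theorem re_sum_quat (f : Fin n → ℍ[ℝ]) : (∑ l, f l).re = ∑ l, (f l).re :=
  map_sum (QuaternionAlgebra.reₗ _ _ _) _ _

theorem imI_sum_quat (f : Fin n → ℍ[ℝ]) : (∑ l, f l).imI = ∑ l, (f l).imI :=
  map_sum (QuaternionAlgebra.imIₗ _ _ _) _ _

theorem imJ_sum_quat (f : Fin n → ℍ[ℝ]) : (∑ l, f l).imJ = ∑ l, (f l).imJ :=
  map_sum (QuaternionAlgebra.imJₗ _ _ _) _ _

theorem imK_sum_quat (f : Fin n → ℍ[ℝ]) : (∑ l, f l).imK = ∑ l, (f l).imK :=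
  map_sum (QuaternionAlgebra.imKₗ _ _ _) _ _

/-- The closing condition: the sum of the Hopf images vanishes. -/
theorem sum_hopf_eq_zero_iff (q : QuatSpace n) :
    ∑ l, hopfList q l = 0 ↔ ∑ l, star (q l) * quatI * q l = 0 := by
  have hre : (∑ l, star (q l) * quatI * q l).re = 0 := by
    rw [re_sum_quat]
    exact Finset.sum_eq_zero fun l _ => by simp; ring
  have h : ∀ k, (∑ l, hopfList q l) k = ∑ l, hopf (q l) k := fun k => by
    rw [WithLp.ofLp_sum, Finset.sum_apply]; rfl
  have h0 : (∑ l, hopfList q l) 0 = (∑ l, star (q l) * quatI * q l).imI := by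
    rw [h, imI_sum_quat]; rfl
  have h1 : (∑ l, hopfList q l) 1 = (∑ l, star (q l) * quatI * q l).imJ := by
    rw [h, imJ_sum_quat]; rfl
  have h2 : (∑ l, hopfList q l) 2 = (∑ l, star (q l) * quatI * q l).imK := by
    rw [h, imK_sum_quat]; rfl
  constructor
  · intro hz
    rw [hz] at h0 h1 h2
    exact Quaternion.ext_iff.2 ⟨hre, h0.symm, h1.symm, h2.symm⟩
  · intro hz
    rw [hz] at h0 h1 h2
    ext k
    fin_cases k
    exacts [h0, h1, h2]

/-- Real and imaginary parts of the closing condition, with the length normalization. -/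
theorem moments_of_closed {q : QuatSpace n} (h2 : ‖q‖ ^ 2 = 2)
    (h : ∑ l, star (q l) * quatI * q l = 0) :
    ∑ l, ((q l).re ^ 2 + (q l).imI ^ 2) = 1 ∧ ∑ l, ((q l).imJ ^ 2 + (q l).imK ^ 2) = 1 ∧
      ∑ l, ((q l).imI * (q l).imJ - (q l).re * (q l).imK) = 0 ∧
      ∑ l, ((q l).imI * (q l).imK + (q l).re * (q l).imJ) = 0 := by
  have hz := (sum_hopf_eq_zero_iff q).2 h
  have hk : ∀ k, ∑ l, hopf (q l) k = 0 := fun k => by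
    have := congrArg (fun v : Space => v k) hz
    simp only [WithLp.ofLp_sum, Finset.sum_apply] at this
    exact this
  have h0 := hk 0
  have h1 := hk 1
  have h3 := hk 2
  simp only [hopf_zero, hopf_one, hopf_two, ← Finset.mul_sum] at h0 h1 h3
  rw [norm_sq_quatSpace] at h2
  have e1 : ∑ l, ((q l).re ^ 2 + (q l).imI ^ 2) + ∑ l, ((q l).imJ ^ 2 + (q l).imK ^ 2) = 2 := by
    rw [← Finset.sum_add_distrib]
    refine Eq.trans ?_ h2
    exact Finset.sum_congr rfl fun l _ => by ring
  have e2 : ∑ l, ((q l).re ^ 2 + (q l).imI ^ 2) - ∑ l, ((q l).imJ ^ 2 + (q l).imK ^ 2) = 0 := by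
    rw [← Finset.sum_sub_distrib]
    refine Eq.trans ?_ h0
    exact Finset.sum_congr rfl fun l _ => by ring
  exact ⟨by linarith, by linarith, by linarith, by linarith⟩

theorem norm_sq_and_closed_of_mem_Pol3 {q : QuatSpace n} (h : hopfList q ∈ Pol3 n) :
    ‖q‖ ^ 2 = 2 ∧ ∑ l, star (q l) * quatI * q l = 0 := by
  refine ⟨?_, (sum_hopf_eq_zero_iff q).1 h.2⟩
  rw [PiLp.norm_sq_eq_of_L2, ← show ∑ l, ‖hopfList q l‖ = 2 from h.1]
  exact Finset.sum_congr rfl fun l _ => (norm_hopf _).symm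

/-- Replaces frames by two equations that reflections visibly preserve, through `norm_reflect` and
`sum_star_mul_mul_reflect` with `z = quatI`. -/
theorem mem_modelPol3_iff {q : QuatSpace n} :
    q ∈ modelPol3 n ↔ ‖q‖ ^ 2 = 2 ∧ ∑ l, star (q l) * quatI * q l = 0 := by
  refine ⟨fun hq => norm_sq_and_closed_of_mem_Pol3 (hopfList_mem_Pol3 hq), fun ⟨h2, h⟩ => ?_⟩
  obtain ⟨m1, m2, m3, m4⟩ := moments_of_closed h2 h
  refine ⟨WithLp.toLp 2 fun l => ⟨(q l).re, (q l).imI⟩,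
    WithLp.toLp 2 fun l => ⟨(q l).imJ, (q l).imK⟩, ?_, ?_, ?_, fun l => ?_⟩
  · rw [← sq_eq_sq₀ (norm_nonneg _) zero_le_one, EuclideanSpace.norm_sq_eq, one_pow]
    refine Eq.trans ?_ m1
    exact Finset.sum_congr rfl fun l _ => by
      rw [← Complex.normSq_eq_norm_sq, Complex.normSq_apply]; ring
  · rw [← sq_eq_sq₀ (norm_nonneg _) zero_le_one, EuclideanSpace.norm_sq_eq, one_pow]
    refine Eq.trans ?_ m2
    exact Finset.sum_congr rfl fun l _ => by
      rw [← Complex.normSq_eq_norm_sq, Complex.normSq_apply]; ring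
  · rw [PiLp.inner_apply]
    apply Complex.ext
    · rw [Complex.re_sum, Complex.zero_re]
      refine Eq.trans ?_ m4
      exact Finset.sum_congr rfl fun l _ => by simp; ring
    · rw [Complex.im_sum, Complex.zero_im]
      refine Eq.trans ?_ ((Finset.sum_neg_distrib _).trans (by rw [m3, neg_zero]))
      exact Finset.sum_congr rfl fun l _ => by simp; ring
  · ext <;> simp

theorem mem_modelPol2_iff {q : QuatSpace n} :
    q ∈ modelPol2 n ↔ q ∈ modelPol3 n ∧
      ((∀ l, (q l).imI = 0 ∧ (q l).imK = 0) ∨ (∀ l, (q l).re = 0 ∧ (q l).imJ = 0)) := by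
  refine ⟨fun hq => ⟨mem_modelPol3_iff.2 (norm_sq_and_closed_of_mem_Pol3
    ⟨(hopfList_mem_Pol2 hq).1.1, (hopfList_mem_Pol2 hq).2⟩), ?_⟩, fun ⟨hq, h⟩ => ?_⟩
  · obtain ⟨u, v, -, -, -, h⟩ := hq
    rcases h with h | h
    · exact Or.inl fun l => by simp [h l]
    · exact Or.inr fun l => by simp [h l]
  · rw [mem_modelPol3_iff] at hq
    obtain ⟨m1, m2, m3, m4⟩ := moments_of_closed hq.1 hq.2
    rcases h with h | h
    · refine ⟨WithLp.toLp 2 fun l => (q l).re, WithLp.toLp 2 fun l => (q l).imJ, ?_, ?_, ?_,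
        Or.inl fun l => ?_⟩
      · rw [← sq_eq_sq₀ (norm_nonneg _) zero_le_one, EuclideanSpace.norm_sq_eq, one_pow]
        refine Eq.trans ?_ m1
        exact Finset.sum_congr rfl fun l _ => by simp [h l]
      · rw [← sq_eq_sq₀ (norm_nonneg _) zero_le_one, EuclideanSpace.norm_sq_eq, one_pow]
        refine Eq.trans ?_ m2
        exact Finset.sum_congr rfl fun l _ => by simp [h l]
      · rw [PiLp.inner_apply]
        refine Eq.trans ?_ m4
        exact Finset.sum_congr rfl fun l _ => by simp [h l]; ring
      · ext <;> simp [h l]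
    · refine ⟨WithLp.toLp 2 fun l => (q l).imI, WithLp.toLp 2 fun l => (q l).imK, ?_, ?_, ?_,
        Or.inr fun l => ?_⟩
      · rw [← sq_eq_sq₀ (norm_nonneg _) zero_le_one, EuclideanSpace.norm_sq_eq, one_pow]
        refine Eq.trans ?_ m1
        exact Finset.sum_congr rfl fun l _ => by simp [h l]
      · rw [← sq_eq_sq₀ (norm_nonneg _) zero_le_one, EuclideanSpace.norm_sq_eq, one_pow]
        refine Eq.trans ?_ m2
        exact Finset.sum_congr rfl fun l _ => by simp [h l]
      · rw [PiLp.inner_apply]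
        refine Eq.trans ?_ m4
        exact Finset.sum_congr rfl fun l _ => by simp [h l]; ring
      · ext <;> simp [h l]

theorem quatJ_commute_iff (x : ℍ[ℝ]) :
    quatJ * x = (1 : ℝ) • (x * quatJ) ↔ x.imI = 0 ∧ x.imK = 0 := by
  rw [Quaternion.ext_iff]
  simp
  constructor <;> rintro ⟨h1, h2⟩ <;> constructor <;> linarith

theorem quatJ_anticommute_iff (x : ℍ[ℝ]) :
    quatJ * x = (-1 : ℝ) • (x * quatJ) ↔ x.re = 0 ∧ x.imJ = 0 := by
  rw [Quaternion.ext_iff]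
  simp
  constructor <;> rintro ⟨h1, h2⟩ <;> constructor <;> linarith

theorem reflect_planar {w q : QuatSpace n} (hw : CommutesWith quatJ w)
    (h : (∀ l, (q l).imI = 0 ∧ (q l).imK = 0) ∨ (∀ l, (q l).re = 0 ∧ (q l).imJ = 0)) :
    (∀ l, (reflect w q l).imI = 0 ∧ (reflect w q l).imK = 0) ∨
      (∀ l, (reflect w q l).re = 0 ∧ (reflect w q l).imJ = 0) := by
  rcases h with h | h
  · exact Or.inl fun l => (quatJ_commute_iff _).1
      (reflect_commute hw (fun l => (quatJ_commute_iff _).2 (h l)) l)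
  · exact Or.inr fun l => (quatJ_anticommute_iff _).1
      (reflect_commute hw (fun l => (quatJ_anticommute_iff _).2 (h l)) l)

theorem reflect_mem_modelArm3 {w q : QuatSpace n} (hq : q ∈ modelArm3 n) :
    reflect w q ∈ modelArm3 n := by
  rw [mem_modelArm3_iff] at *
  rw [norm_reflect, hq]

theorem reflect_mem_modelArm2 {w q : QuatSpace n} (hw : CommutesWith quatJ w)
    (hq : q ∈ modelArm2 n) : reflect w q ∈ modelArm2 n :=
  ⟨reflect_mem_modelArm3 hq.1, reflect_planar hw hq.2⟩

theorem reflect_mem_modelPol3 {w q : QuatSpace n} (hw : CommutesWith quatI w)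
    (hq : q ∈ modelPol3 n) : reflect w q ∈ modelPol3 n := by
  rw [mem_modelPol3_iff] at *
  rw [norm_reflect, sum_star_mul_mul_reflect hw]
  exact hq

theorem reflect_mem_modelPol2 {w q : QuatSpace n} (hI : CommutesWith quatI w)
    (hJ : CommutesWith quatJ w) (hq : q ∈ modelPol2 n) : reflect w q ∈ modelPol2 n := by
  rw [mem_modelPol2_iff] at *
  exact ⟨reflect_mem_modelPol3 hI hq.1, reflect_planar hJ hq.2⟩

end Models

/-! ### Spaces of Gaussian directions inside ℍⁿ. -/

section Embeddings

variable {n : ℕ}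

/-- `ℂⁿ` as `(ℝ ⊕ ℝ𝐢)ⁿ`. -/
noncomputable def complexToQuat (a : EuclideanSpace ℂ (Fin n)) : QuatSpace n :=
  WithLp.toLp 2 fun l => ((a l).re : ℍ[ℝ]) + ((a l).im : ℍ[ℝ]) * quatI

/-- `ℂⁿ` as `(ℝ ⊕ ℝ𝐣)ⁿ`. -/
noncomputable def complexToQuatJ (a : EuclideanSpace ℂ (Fin n)) : QuatSpace n :=
  WithLp.toLp 2 fun l => ((a l).re : ℍ[ℝ]) + ((a l).im : ℍ[ℝ]) * quatJ

/-- `ℝⁿ` inside `ℍⁿ`. -/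
noncomputable def realToQuat (a : EuclideanSpace ℝ (Fin n)) : QuatSpace n :=
  WithLp.toLp 2 fun l => ((a l : ℝ) : ℍ[ℝ])

theorem norm_complexToQuat (a : EuclideanSpace ℂ (Fin n)) : ‖complexToQuat a‖ = ‖a‖ := by
  rw [← sq_eq_sq₀ (norm_nonneg _) (norm_nonneg _), norm_sq_quatSpace, EuclideanSpace.norm_sq_eq]
  exact Finset.sum_congr rfl fun l _ => by
    rw [← Complex.normSq_eq_norm_sq, Complex.normSq_apply]; simp [complexToQuat]; ring

theorem norm_complexToQuatJ (a : EuclideanSpace ℂ (Fin n)) : ‖complexToQuatJ a‖ = ‖a‖ := by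
  rw [← sq_eq_sq₀ (norm_nonneg _) (norm_nonneg _), norm_sq_quatSpace, EuclideanSpace.norm_sq_eq]
  exact Finset.sum_congr rfl fun l _ => by
    rw [← Complex.normSq_eq_norm_sq, Complex.normSq_apply]; simp [complexToQuatJ]; ring

theorem norm_realToQuat (a : EuclideanSpace ℝ (Fin n)) : ‖realToQuat a‖ = ‖a‖ := by
  rw [← sq_eq_sq₀ (norm_nonneg _) (norm_nonneg _), norm_sq_quatSpace, EuclideanSpace.norm_sq_eq]
  exact Finset.sum_congr rfl fun l _ => by simp [realToQuat]

theorem continuous_complexToQuat : Continuous (complexToQuat (n := n)) := by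
  refine (PiLp.continuous_toLp 2 _).comp (continuous_pi fun l => ?_)
  exact (Quaternion.continuous_coe.comp (by fun_prop)).add
    ((Quaternion.continuous_coe.comp (by fun_prop)).mul continuous_const)

theorem continuous_complexToQuatJ : Continuous (complexToQuatJ (n := n)) := by
  refine (PiLp.continuous_toLp 2 _).comp (continuous_pi fun l => ?_)
  exact (Quaternion.continuous_coe.comp (by fun_prop)).add
    ((Quaternion.continuous_coe.comp (by fun_prop)).mul continuous_const)

theorem continuous_realToQuat : Continuous (realToQuat (n := n)) := by
  refine (PiLp.continuous_toLp 2 _).comp (continuous_pi fun l => ?_)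
  exact Quaternion.continuous_coe.comp (by fun_prop)

theorem continuous_quatForm :
    Continuous fun z : QuatSpace n × QuatSpace n => quatForm z.1 z.2 := by
  unfold quatForm
  fun_prop

theorem commutesWith_quatI_complexToQuat (a : EuclideanSpace ℂ (Fin n)) :
    CommutesWith quatI (complexToQuat a) := fun l => by
  constructor <;> ext <;> simp [complexToQuat]

theorem commutesWith_quatJ_complexToQuatJ (a : EuclideanSpace ℂ (Fin n)) :
    CommutesWith quatJ (complexToQuatJ a) := fun l => by
  constructor <;> ext <;> simp [complexToQuatJ]

theorem commutesWith_realToQuat (z : ℍ[ℝ]) (a : EuclideanSpace ℝ (Fin n)) :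
    CommutesWith z (realToQuat a) := fun l => by
  simp only [realToQuat, Quaternion.star_coe, and_self]
  exact (Quaternion.coe_commutes _ _).symm

end Embeddings

/-! ### The pairing with a fixed point of the model as a projection. -/

section Frames

variable {n : ℕ}

theorem inner_real_eq_re_inner_complex (x y : EuclideanSpace ℂ (Fin n)) :
    inner ℝ x y = (inner ℂ x y).re := by
  rw [PiLp.inner_apply, PiLp.inner_apply, Complex.re_sum]
  rfl

theorem finrank_complexSpace : Module.finrank ℝ (EuclideanSpace ℂ (Fin n)) = 2 * n := by
  rw [← Module.finrank_mul_finrank ℝ ℂ, Complex.finrank_real_complex, finrank_euclideanSpace_fin]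

theorem finrank_quatSpace : Module.finrank ℝ (QuatSpace n) = n * 4 := by
  rw [LinearEquiv.finrank_eq (WithLp.linearEquiv 2 ℝ (Fin n → ℍ[ℝ])), Module.finrank_pi_fintype]
  simp [Quaternion.finrank_eq_four]

theorem orthonormal_complex_line {u : EuclideanSpace ℂ (Fin n)} (hu : ‖u‖ = 1) :
    Orthonormal ℝ ![u, Complex.I • u] := by
  rw [orthonormal_vecCons_iff, orthonormal_vecCons_iff]
  refine ⟨hu, ?_, ?_, by simp, by simp⟩
  · simp [inner_real_eq_re_inner_complex, hu]
  · simp [norm_smul, hu]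

theorem orthonormal_complex_plane {u v : EuclideanSpace ℂ (Fin n)} (hu : ‖u‖ = 1) (hv : ‖v‖ = 1)
    (huv : inner ℂ u v = 0) : Orthonormal ℝ ![u, Complex.I • u, v, Complex.I • v] := by
  rw [orthonormal_vecCons_iff, orthonormal_vecCons_iff]
  refine ⟨hu, ?_, by simp [norm_smul, hu], ?_, orthonormal_complex_line hv⟩
  · rw [Fin.forall_fin_succ]
    simp [inner_real_eq_re_inner_complex, hu, huv]
  · simp [inner_real_eq_re_inner_complex, huv]

theorem inner_sq_add_inner_smul_I_sq (u a : EuclideanSpace ℂ (Fin n)) :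
    inner ℝ u a ^ 2 + inner ℝ (Complex.I • u) a ^ 2 = ‖inner ℂ a u‖ ^ 2 := by
  rw [norm_inner_symm, ← Complex.normSq_eq_norm_sq, Complex.normSq_apply,
    inner_real_eq_re_inner_complex, inner_real_eq_re_inner_complex, inner_smul_left]
  simp
  ring

/-- Conjugates of coordinates in ℝ ⊕ ℝ𝐢 multiply `u + v 𝐣` from the left, hence act on `u` and `v`
separately. -/
theorem quatForm_complexToQuat (a u v : EuclideanSpace ℂ (Fin n)) {q : QuatSpace n}
    (hq : ∀ l, q l = ((u l : ℂ) : ℍ[ℝ]) + ((v l : ℂ) : ℍ[ℝ]) * quatJ) :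
    quatForm (complexToQuat a) q =
      ((inner ℂ a u : ℂ) : ℍ[ℝ]) + ((inner ℂ a v : ℂ) : ℍ[ℝ]) * quatJ := by
  rw [quatForm, PiLp.inner_apply, PiLp.inner_apply]
  refine Quaternion.ext_iff.2 ⟨?_, ?_, ?_, ?_⟩
  · rw [re_sum_quat]
    simp [hq, complexToQuat]
    exact Finset.sum_congr rfl fun l _ => by ring
  · rw [imI_sum_quat]
    simp [hq, complexToQuat]
    exact Finset.sum_congr rfl fun l _ => by ring
  · rw [imJ_sum_quat]
    simp [hq, complexToQuat]
    exact Finset.sum_congr rfl fun l _ => by ring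
  · rw [imK_sum_quat]
    simp [hq, complexToQuat]
    exact Finset.sum_congr rfl fun l _ => by ring

theorem norm_sq_add_mul_quatJ (x y : ℂ) :
    ‖(x : ℍ[ℝ]) + (y : ℍ[ℝ]) * quatJ‖ ^ 2 = ‖x‖ ^ 2 + ‖y‖ ^ 2 := by
  rw [norm_sq_quat, ← Complex.normSq_eq_norm_sq, ← Complex.normSq_eq_norm_sq,
    Complex.normSq_apply, Complex.normSq_apply]
  simp
  ring

theorem norm_quatI : ‖quatI‖ = 1 := by
  rw [← sq_eq_sq₀ (norm_nonneg _) zero_le_one, norm_sq_quat]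
  simp

theorem exists_frame_of_mem_modelPol3 {q : QuatSpace n} (hq : q ∈ modelPol3 n) :
    ∃ w : Fin 4 → EuclideanSpace ℂ (Fin n), Orthonormal ℝ w ∧
      ∀ a, ‖quatForm (complexToQuat a) q‖ ^ 2 = ∑ j, inner ℝ (w j) a ^ 2 := by
  obtain ⟨u, v, hu, hv, huv, h⟩ := hq
  refine ⟨_, orthonormal_complex_plane hu hv huv, fun a => ?_⟩
  rw [quatForm_complexToQuat a u v h, norm_sq_add_mul_quatJ, ← inner_sq_add_inner_smul_I_sq,
    ← inner_sq_add_inner_smul_I_sq, Fin.sum_univ_four]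
  simp
  ring

theorem quatForm_realToQuat (a u v : EuclideanSpace ℝ (Fin n)) {q : QuatSpace n} {x : ℍ[ℝ]}
    (hq : ∀ l, q l = x * (((u l : ℝ) : ℍ[ℝ]) + ((v l : ℝ) : ℍ[ℝ]) * quatJ)) :
    quatForm (realToQuat a) q =
      x * (((inner ℝ a u : ℝ) : ℍ[ℝ]) + ((inner ℝ a v : ℝ) : ℍ[ℝ]) * quatJ) := by
  have hc : ∀ y : EuclideanSpace ℝ (Fin n),
      ((inner ℝ a y : ℝ) : ℍ[ℝ]) = ∑ l, ((a l : ℝ) : ℍ[ℝ]) * ((y l : ℝ) : ℍ[ℝ]) := fun y => by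
    have h := map_sum (algebraMap ℝ ℍ[ℝ]) (fun l => inner ℝ (a l) (y l)) Finset.univ
    rw [PiLp.inner_apply]
    refine h.trans (Finset.sum_congr rfl fun l _ => ?_)
    rw [← Quaternion.coe_mul, mul_comm]
    rfl
  rw [quatForm, hc, hc, Finset.sum_mul, ← Finset.sum_add_distrib, Finset.mul_sum]
  refine Finset.sum_congr rfl fun l _ => ?_
  have h : star (realToQuat a l) = ((a l : ℝ) : ℍ[ℝ]) := by simp [realToQuat]
  rw [h, hq, ← mul_assoc, Quaternion.coe_commutes, mul_assoc, mul_add, mul_assoc]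

/-- Real directions commute with 𝐢, so on the second component the unit factor 𝐢 comes out of the
pairing and `u`, `v` serve as frame on both. -/
theorem exists_frame_of_mem_modelPol2 {q : QuatSpace n} (hq : q ∈ modelPol2 n) :
    ∃ w : Fin 2 → EuclideanSpace ℝ (Fin n), Orthonormal ℝ w ∧
      ∀ a, ‖quatForm (realToQuat a) q‖ ^ 2 = ∑ j, inner ℝ (w j) a ^ 2 := by
  obtain ⟨u, v, hu, hv, huv, h⟩ := hq
  obtain ⟨x, hx, hq⟩ : ∃ x : ℍ[ℝ], ‖x‖ = 1 ∧
      ∀ l, q l = x * (((u l : ℝ) : ℍ[ℝ]) + ((v l : ℝ) : ℍ[ℝ]) * quatJ) := by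
    rcases h with h | h
    · exact ⟨1, norm_one, by simpa using h⟩
    · exact ⟨quatI, norm_quatI, h⟩
  refine ⟨![u, v], ?_, fun a => ?_⟩
  · rw [orthonormal_vecCons_iff, orthonormal_vecCons_iff]
    exact ⟨hu, by simp [huv], hv, by simp, by simp⟩
  · rw [quatForm_realToQuat a u v hq, norm_mul, hx, one_mul, norm_sq_quat, Fin.sum_univ_two]
    simp [real_inner_comm a]

theorem quatForm_complexToQuatJ (a z : EuclideanSpace ℂ (Fin n)) :
    quatForm (complexToQuatJ a) (complexToQuatJ z) =
      ((inner ℂ a z).re : ℍ[ℝ]) + ((inner ℂ a z).im : ℍ[ℝ]) * quatJ := by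
  rw [quatForm, PiLp.inner_apply]
  refine Quaternion.ext_iff.2 ⟨?_, ?_, ?_, ?_⟩
  · rw [re_sum_quat]
    simp [complexToQuatJ]
    exact Finset.sum_congr rfl fun l _ => by ring
  · rw [imI_sum_quat]
    simp [complexToQuatJ]
  · rw [imJ_sum_quat]
    simp [complexToQuatJ]
    exact Finset.sum_congr rfl fun l _ => by ring
  · rw [imK_sum_quat]
    simp [complexToQuatJ]

/-- Here 𝐢 does not commute with the directions, so it is factored out on the right, where it does
not affect norms. The factor 2 is the squared radius. -/
theorem exists_frame_of_mem_modelArm2 {q : QuatSpace n} (hq : q ∈ modelArm2 n) :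
    ∃ w : Fin 2 → EuclideanSpace ℂ (Fin n), Orthonormal ℝ w ∧
      ∀ a, ‖quatForm (complexToQuatJ a) q‖ ^ 2 = 2 * ∑ j, inner ℝ (w j) a ^ 2 := by
  obtain ⟨x, z, hx, hqz⟩ : ∃ (x : ℍ[ℝ]) (z : EuclideanSpace ℂ (Fin n)), ‖x‖ = 1 ∧
      ∀ l, q l = complexToQuatJ z l * x := by
    rcases hq.2 with h | h
    · refine ⟨1, WithLp.toLp 2 fun l => ⟨(q l).re, (q l).imJ⟩, norm_one, fun l => ?_⟩
      ext <;> simp [complexToQuatJ, h l]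
    -- The sign comes from `(α + β𝐣)𝐢 = α𝐢 - β𝐤`.
    · refine ⟨quatI, WithLp.toLp 2 fun l => ⟨(q l).imI, -(q l).imK⟩, norm_quatI, fun l => ?_⟩
      ext <;> simp [complexToQuatJ, h l]
  have hz : ‖z‖ = √2 := by
    rw [← norm_complexToQuatJ, ← mem_modelArm3_iff.1 hq.1,
      ← sq_eq_sq₀ (norm_nonneg _) (norm_nonneg _), PiLp.norm_sq_eq_of_L2, PiLp.norm_sq_eq_of_L2]
    exact Finset.sum_congr rfl fun l _ => by rw [hqz, norm_mul, hx, mul_one]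
  have h2 : (√2 : ℝ) ≠ 0 := by positivity
  have hF : ∀ a, quatForm (complexToQuatJ a) q =
      quatForm (complexToQuatJ a) (complexToQuatJ z) * x := fun a => by
    rw [quatForm, quatForm, Finset.sum_mul]
    exact Finset.sum_congr rfl fun l _ => by rw [hqz, mul_assoc]
  let u : EuclideanSpace ℂ (Fin n) := (((√2)⁻¹ : ℝ) : ℂ) • z
  have hu : ‖u‖ = 1 := by
    rw [norm_smul, hz, Complex.norm_real, Real.norm_of_nonneg (by positivity), inv_mul_cancel₀ h2]
  refine ⟨_, orthonormal_complex_line hu, fun a => ?_⟩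
  have hs := inner_sq_add_inner_smul_I_sq u a
  have hn : ‖inner ℂ a u‖ ^ 2 = ‖inner ℂ a z‖ ^ 2 / 2 := by
    rw [inner_smul_right, norm_mul, Complex.norm_real, mul_pow, norm_inv, inv_pow,
      Real.norm_of_nonneg (by positivity), Real.sq_sqrt (by norm_num)]
    ring
  rw [hF, norm_mul, hx, mul_one, quatForm_complexToQuatJ, norm_sq_quat, Fin.sum_univ_two]
  simp only [Matrix.cons_val_zero, Matrix.cons_val_one, hs, hn]
  rw [← Complex.normSq_eq_norm_sq, Complex.normSq_apply]
  simp
  ring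

/-- Coordinatewise right multiplication by a quaternion. -/
noncomputable def rightMul (q : QuatSpace n) (x : ℍ[ℝ]) : QuatSpace n :=
  WithLp.toLp 2 fun l => q l * x

theorem inner_rightMul_left (q a : QuatSpace n) (x : ℍ[ℝ]) :
    inner ℝ (rightMul q x) a = (star x * quatForm q a).re := by
  rw [inner_eq_re_quatForm]
  simp [quatForm, rightMul, Finset.mul_sum, mul_assoc]

theorem inner_rightMul_rightMul (q : QuatSpace n) (x y : ℍ[ℝ]) :
    inner ℝ (rightMul q x) (rightMul q y) = ‖q‖ ^ 2 * (star x * y).re := by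
  rw [inner_rightMul_left]
  have h : quatForm q (rightMul q y) = ((‖q‖ ^ 2 : ℝ) : ℍ[ℝ]) * y := by
    rw [← quatForm_self, quatForm, quatForm, Finset.sum_mul]
    exact Finset.sum_congr rfl fun l _ => (mul_assoc _ _ _).symm
  rw [h, ← mul_assoc, ← Quaternion.coe_commutes, mul_assoc, Quaternion.coe_mul_eq_smul]
  simp

/-- The real inner products of `a` with `q`, `q𝐢`, `q𝐣`, `q𝐤` are the four components of `⟨q, a⟩`,
the conjugate of `⟨a, q⟩`. These vectors are orthogonal of length `‖q‖ = √2`. -/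
theorem exists_frame_of_mem_modelArm3 {q : QuatSpace n} (hq : q ∈ modelArm3 n) :
    ∃ w : Fin 4 → QuatSpace n, Orthonormal ℝ w ∧
      ∀ a, ‖quatForm a q‖ ^ 2 = 2 * ∑ j, inner ℝ (w j) a ^ 2 := by
  have hqn : ‖q‖ ^ 2 = 2 := by rw [mem_modelArm3_iff.1 hq]; exact Real.sq_sqrt (by norm_num)
  let e : Fin 4 → ℍ[ℝ] := ![1, quatI, quatJ, quatI * quatJ]
  have hs : (√2)⁻¹ * (√2)⁻¹ = (2 : ℝ)⁻¹ := by
    rw [← mul_inv, Real.mul_self_sqrt (by norm_num)]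
  refine ⟨fun j => (√2)⁻¹ • rightMul q (e j), ?_, fun a => ?_⟩
  · rw [orthonormal_iff_ite]
    intro j k
    rw [real_inner_smul_left, real_inner_smul_right, inner_rightMul_rightMul, hqn, ← mul_assoc,
      hs, inv_mul_cancel_left₀ two_ne_zero]
    fin_cases j <;> fin_cases k <;> simp [e]
  · have hsq : (√2)⁻¹ ^ 2 = (2 : ℝ)⁻¹ := by rw [sq, hs]
    rw [← norm_star, star_quatForm, norm_sq_quat, Fin.sum_univ_four]
    simp only [real_inner_smul_left, mul_pow, inner_rightMul_left, hsq]
    simp [e]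
    ring

end Frames

/-! ### Tail bounds on the four models and transfer to edge lengths. -/

section Tails

variable {n : ℕ}

theorem normalizedVolume_modelArm3_lt (hn : 2 ≤ n) (i : Fin n) {t : ℝ} (ht : 0 < t)
    (hnt : 4 < n * t) (d : ℝ) :
    normalizedVolume (modelArm3 n) d {q | t ≤ ‖q.1 i‖ ^ 2} <
      ENNReal.ofReal ((1 + n * t) * Real.exp (-(n * t))) := by
  have hdim : (Module.finrank ℝ (QuatSpace n) : ℝ) = 2 * (2 * n) := by
    rw [finrank_quatSpace]; push_cast; ring
  -- Here `M = 2n`, and the factor 2 in the frame formula lowers the height to `t / 2`, so `Mx =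
  -- nt`.
  obtain ⟨p, hp, hcap⟩ := exists_gaussianWeight_cap_four_bound (QuatSpace n) hdim (half_pos ht)
    (by linarith)
  have : Nontrivial (QuatSpace n) :=
    Module.nontrivial_of_finrank_pos (R := ℝ) (by rw [finrank_quatSpace]; omega)
  rw [show (2 * n : ℝ) * (t / 2) = n * t by ring] at hp
  refine lt_of_le_of_lt (normalizedVolume_tail_le (F := fun a q => ‖quatForm a q‖ ^ 2) d i
    (continuous_quatForm.norm.pow 2) (fun a ha => ?_) fun q hq => ?_) hp
  · exact exists_reflectOn ha (fun w _ q hq => reflect_mem_modelArm3 hq) i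
  · obtain ⟨w, hw, hsum⟩ := exists_frame_of_mem_modelArm3 hq
    refine le_of_eq_of_le (congrArg _ (Set.ext fun a => ?_)) (hcap w hw)
    simp only [Set.mem_ofPred_eq, hsum]
    constructor <;> intro h <;> linarith

theorem normalizedVolume_modelPol3_lt (hn : 2 ≤ n) (i : Fin n) {t : ℝ} (ht : 0 < t)
    (hnt : 4 < n * t) (d : ℝ) :
    normalizedVolume (modelPol3 n) d {q | t ≤ ‖q.1 i‖ ^ 2} <
      ENNReal.ofReal ((1 + n * t) * Real.exp (-(n * t))) := by
  have hdim : (Module.finrank ℝ (EuclideanSpace ℂ (Fin n)) : ℝ) = 2 * n := by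
    rw [finrank_complexSpace]; push_cast; ring
  obtain ⟨p, hp, hcap⟩ := exists_gaussianWeight_cap_four_bound _ hdim ht hnt
  have : Nontrivial (EuclideanSpace ℂ (Fin n)) :=
    Module.nontrivial_of_finrank_pos (R := ℝ) (by rw [finrank_complexSpace]; omega)
  refine lt_of_le_of_lt (normalizedVolume_tail_le
    (F := fun (a : EuclideanSpace ℂ (Fin n)) q => ‖quatForm (complexToQuat a) q‖ ^ 2) d i
    ?_ (fun a ha => ?_) fun q hq => ?_) hp
  · exact (continuous_quatForm.comp
      (continuous_complexToQuat.prodMap continuous_id)).norm.pow 2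
  · rw [← norm_complexToQuat]
    refine exists_reflectOn (fun h => ha ?_) (fun w hw q hq => reflect_mem_modelPol3
      (hw _ (commutesWith_quatI_complexToQuat a)) hq) i
    rw [← norm_eq_zero, ← norm_complexToQuat, h, norm_zero]
  · obtain ⟨w, hw, hsum⟩ := exists_frame_of_mem_modelPol3 hq
    simp only [hsum]
    exact hcap w hw

theorem normalizedVolume_modelArm2_lt (hn : 2 ≤ n) (i : Fin n) {t : ℝ} (ht : 0 < t)
    (hnt : 4 < n * t) (d : ℝ) :
    normalizedVolume (modelArm2 n) d {q | t ≤ ‖q.1 i‖ ^ 2} <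
      ENNReal.ofReal (Real.exp (-(n * t / 2))) := by
  have hdim : (Module.finrank ℝ (EuclideanSpace ℂ (Fin n)) : ℝ) = 2 * n := by
    rw [finrank_complexSpace]; push_cast; ring
  obtain ⟨p, hp, hcap⟩ := exists_gaussianWeight_cap_two_bound _ hdim (half_pos ht) (by linarith)
  have : Nontrivial (EuclideanSpace ℂ (Fin n)) :=
    Module.nontrivial_of_finrank_pos (R := ℝ) (by rw [finrank_complexSpace]; omega)
  rw [← mul_div_assoc] at hp
  refine lt_of_le_of_lt (normalizedVolume_tail_le
    (F := fun (a : EuclideanSpace ℂ (Fin n)) q => ‖quatForm (complexToQuatJ a) q‖ ^ 2) d i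
    ?_ (fun a ha => ?_) fun q hq => ?_) hp
  · exact (continuous_quatForm.comp
      (continuous_complexToQuatJ.prodMap continuous_id)).norm.pow 2
  · rw [← norm_complexToQuatJ]
    refine exists_reflectOn (fun h => ha ?_) (fun w hw q hq => reflect_mem_modelArm2
      (hw _ (commutesWith_quatJ_complexToQuatJ a)) hq) i
    rw [← norm_eq_zero, ← norm_complexToQuatJ, h, norm_zero]
  · obtain ⟨w, hw, hsum⟩ := exists_frame_of_mem_modelArm2 hq
    refine le_of_eq_of_le (congrArg _ (Set.ext fun a => ?_)) (hcap w hw)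
    simp only [Set.mem_ofPred_eq, hsum]
    constructor <;> intro h <;> linarith

theorem normalizedVolume_modelPol2_lt (hn : 2 ≤ n) (i : Fin n) {t : ℝ} (ht : 0 < t)
    (hnt : 4 < n * t) (d : ℝ) :
    normalizedVolume (modelPol2 n) d {q | t ≤ ‖q.1 i‖ ^ 2} <
      ENNReal.ofReal (Real.exp (-(n * t / 2))) := by
  have hdim : (Module.finrank ℝ (EuclideanSpace ℝ (Fin n)) : ℝ) = 2 * (n / 2) := by
    rw [finrank_euclideanSpace_fin]; ring
  -- For closed plane polygons the halving sits in `M = n / 2`; the height is `t` itself.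
  obtain ⟨p, hp, hcap⟩ := exists_gaussianWeight_cap_two_bound _ hdim ht (by linarith)
  have : Nontrivial (EuclideanSpace ℝ (Fin n)) :=
    Module.nontrivial_of_finrank_pos (R := ℝ) (by rw [finrank_euclideanSpace_fin]; omega)
  rw [show (n / 2 : ℝ) * t = n * t / 2 by ring] at hp
  refine lt_of_le_of_lt (normalizedVolume_tail_le
    (F := fun (a : EuclideanSpace ℝ (Fin n)) q => ‖quatForm (realToQuat a) q‖ ^ 2) d i
    ?_ (fun a ha => ?_) fun q hq => ?_) hp
  · exact (continuous_quatForm.comp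
      (continuous_realToQuat.prodMap continuous_id)).norm.pow 2
  · rw [← norm_realToQuat]
    refine exists_reflectOn (fun h => ha ?_) (fun w hw q hq => reflect_mem_modelPol2
      (hw _ (commutesWith_realToQuat _ a)) (hw _ (commutesWith_realToQuat _ a)) hq) i
    rw [← norm_eq_zero, ← norm_realToQuat, h, norm_zero]
  · obtain ⟨w, hw, hsum⟩ := exists_frame_of_mem_modelPol2 hq
    simp only [hsum]
    exact hcap w hw

theorem continuous_hopf : Continuous hopf := by
  refine (PiLp.continuous_toLp 2 _).comp (continuous_pi fun k => ?_)
  have h : Continuous fun q : ℍ[ℝ] => star q * quatI * q := by fun_prop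
  fin_cases k
  exacts [Quaternion.continuous_imI.comp h, Quaternion.continuous_imJ.comp h,
    Quaternion.continuous_imK.comp h]

theorem measurable_hopfList : Measurable (hopfList (n := n)) :=
  measurable_pi_lambda _ fun l => by
    have : Continuous fun q : QuatSpace n => hopf (q l) := continuous_hopf.comp (by fun_prop)
    exact this.measurable

/-- The law of the length of the `i`-th edge is read off on the model space. -/
theorem map_edge_length_apply {M : Set (QuatSpace n)} {P : Set (Fin n → Space)}
    (μ : Measure M) {f : M → P} (hf : ∀ q, (f q).1 = hopfList q.1) (i : Fin n) (t : ℝ) :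
    μ.map f {e | ‖e.1 i‖ ≥ t} = μ {q | t ≤ ‖q.1 i‖ ^ 2} := by
  have hfm : Measurable f := by
    refine Measurable.subtype_mk (f := fun q => (f q).1) ?_
    simp only [hf]
    exact measurable_hopfList.comp measurable_subtype_coe
  have hS : MeasurableSet {e : P | ‖e.1 i‖ ≥ t} := by
    have : Measurable fun e : P => ‖e.1 i‖ :=
      ((measurable_pi_apply i).comp measurable_subtype_coe).norm
    exact measurableSet_le measurable_const this
  rw [Measure.map_apply hfm hS]
  congr 1
  ext q
  simp [hf, hopfList, norm_hopf]

end Tails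

end RandomPolygon

open RandomPolygon in
theorem proposition9p3 (n : ℕ) (hn : 2 ≤ n) (i : Fin n) (c : ℝ) (hc : c > 4 / Real.log n) :
    (RandomPolygon.symmArm3 n {e | ‖e.1 i‖ ≥ c * (Real.log n / n)} <
        ENNReal.ofReal ((1 + c * Real.log n) / (n : ℝ) ^ c) ∧
      RandomPolygon.symmPol3 n {e | ‖e.1 i‖ ≥ c * (Real.log n / n)} <
        ENNReal.ofReal ((1 + c * Real.log n) / (n : ℝ) ^ c)) ∧
    (RandomPolygon.symmArm2 n {e | ‖e.1 i‖ ≥ c * (Real.log n / n)} <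
        ENNReal.ofReal (1 / (n : ℝ) ^ (c / 2)) ∧
      RandomPolygon.symmPol2 n {e | ‖e.1 i‖ ≥ c * (Real.log n / n)} <
        ENNReal.ofReal (1 / (n : ℝ) ^ (c / 2))) := by
  have hn0 : (0 : ℝ) < n := by positivity
  have hlog : 0 < Real.log n := Real.log_pos (by exact_mod_cast hn)
  have hcl : 4 < c * Real.log n := (div_lt_iff₀ hlog).1 hc
  set t : ℝ := c * (Real.log n / n) with ht
  have hnt : n * t = c * Real.log n := by rw [ht]; field_simp
  have ht0 : 0 < t := by
    have : t = c * Real.log n / n := by rw [ht, mul_div_assoc]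
    rw [this]; positivity
  have h4 : 4 < n * t := by rw [hnt]; exact hcl
  have e1 : (1 + c * Real.log n) / (n : ℝ) ^ c = (1 + n * t) * Real.exp (-(n * t)) := by
    rw [Real.rpow_def_of_pos hn0, Real.exp_neg, hnt, mul_comm c, div_eq_mul_inv]
  have e2 : 1 / (n : ℝ) ^ (c / 2) = Real.exp (-(n * t / 2)) := by
    rw [Real.rpow_def_of_pos hn0, Real.exp_neg, hnt, one_div]
    congr 2; ring
  rw [e1, e2, symmArm3, symmPol3, symmArm2, symmPol2,
    map_edge_length_apply _ (fun _ => rfl), map_edge_length_apply _ (fun _ => rfl),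
    map_edge_length_apply _ (fun _ => rfl), map_edge_length_apply _ (fun _ => rfl)]
  exact ⟨⟨normalizedVolume_modelArm3_lt hn i ht0 h4 _, normalizedVolume_modelPol3_lt hn i ht0 h4 _⟩,
    normalizedVolume_modelArm2_lt hn i ht0 h4 _, normalizedVolume_modelPol2_lt hn i ht0 h4 _⟩
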